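/- Let $\tau:E\to M$ be a Lie algebroid with anchor $\rho:E\to TM$ and bracket $[\cdot,\cdot]$ on sections. For a map $\pi:P\to M$ put $\mathcal T^E_pP=\{(b,v)\in E_{\pi(p)}\times T_pP : \rho(b)=T_p\pi(v)\}$. On $\mathcal T^EE$ let $b^V_a$ be the tangent vector at $t=0$ of $t\mapsto a+tb$, let $\xi^V(a,b)=(0,b^V_a)$ be the vertical lift, $S(b,v)=\xi^V(a,b)$ for $(b,v)\in\mathcal T^E_aE$, and $\Delta(a)=\xi^V(a,a)$. For $L\in C^\infty(E)$ let $\theta_L=S^*(dL)$, $\omega_L=-d\theta_L$ and $E_L=d_\Delta L-L$, where $d$ is the exterior differential of the Lie algebroid $\mathcal T^EE$. Assume that $L$ is regular, i.e. $\omega_L$ is nondegenerate at every point. Let $\mathcal M\subset E$ be a submanifold such that $\pi=\tau|_{\mathcal M}:\mathcal M\to M$ is a fibration (surjective submersion), so that $\mathcal T^E\mathcal M\subset\mathcal T^EE|_{\mathcal M}$. For $a\in\mathcal M$ put $$\mathcal V_a=\{b\in E_{\tau(a)} : b^V_a\in T_a\mathcal M\},\qquad \Psi_a=S^*\big((\mathcal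 T^E_a\mathcal M)^\circ\big)\subset(\mathcal T^E_aE)^*,\qquad F_a=\{z\in\mathcal T^E_aE : i_z\omega_L\in\Psi_a\},$$ $$\mathcal T^{\mathcal V}_a\mathcal M=\{(b,v)\in\mathcal T^E_a\mathcal M : b\in\mathcal V_a\},\qquad G^{L,\mathcal V}_a(b,c)=\omega_L(\tilde b,\xi^V(a,c))\quad(b,c\in\mathcal V_a),$$ where $\tilde b\in\mathcal T^E_aE$ is any element whose first component is $b$, and let $\perp$ be the orthogonal in $\mathcal T^EE$ with respect to $\omega_L$. Then the following are equivalent: 1. the constrained system $(L,\mathcal M)$ is regular: at every $a\in\mathcal M$ there is exactly one $\Gamma(a)\in\mathcal T^E_a\mathcal M$ that satisfies the Lagrange–d'Alembert equation $(i_{\Gamma(a)}\omega_L-dE_L)_a\in\Psi_a$, and the resulting section $\Gamma$ of $\mathcal T^E\mathcal M\to\mathcal M$ is smooth; 2. $\operatorname{Ker}G^{L,\mathcal V}_a=\{0\}$ for every $a\in\mathcal M$; 3. $\mathcal T^E_a\mathcal M\cap F_a=\{0\}$ for every $a\in\mathcal M$; 4. $\mathcal T^{\mathcal V}_a\mathcal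 M\cap(\mathcal T^{\mathcal V}_a\mathcal M)^\perp=\{0\}$ for every $a\in\mathcal M$. -/

import Mathlib

open Bundle Manifold ContDiff Topology

noncomputable section

set_option linter.unusedSectionVars false

variable {EB : Type*} [NormedAddCommGroup EB] [NormedSpace ℝ EB]
  {M : Type*} [TopologicalSpace M] [ChartedSpace EB M] [IsManifold 𝓘(ℝ, EB) ∞ M]
  {F : Type*} [NormedAddCommGroup F] [NormedSpace ℝ F]
  {E : M → Type*} [∀ x, AddCommGroup (E x)] [∀ x, Module ℝ (E x)]
  [∀ x, TopologicalSpace (E x)] [TopologicalSpace (TotalSpace F E)]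
  [FiberBundle F E] [VectorBundle ℝ F E] [ContMDiffVectorBundle ∞ F E 𝓘(ℝ, EB)]

/-- The differential `T_x N → ℝ` at `x` of a real function `f` on a manifold `N`. -/
def differential {EN : Type*} [NormedAddCommGroup EN] [NormedSpace ℝ EN] {HN : Type*}
    [TopologicalSpace HN] (IN : ModelWithCorners ℝ EN HN) {N : Type*} [TopologicalSpace N]
    [ChartedSpace HN N] (f : N → ℝ) (x : N) : TangentSpace IN x →ₗ[ℝ] ℝ :=
  (mfderiv IN 𝓘(ℝ, ℝ) f x).toLinearMap

/-- The product `f • σ` of a smooth function and a smooth section. -/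
def smulSection (f : C^∞⟮𝓘(ℝ, EB), M; ℝ⟯) (σ : Cₛ^∞⟮𝓘(ℝ, EB); F, E⟯) :
    Cₛ^∞⟮𝓘(ℝ, EB); F, E⟯ :=
  ⟨fun x => f x • σ x, f.contMDiff.smul_section σ.contMDiff⟩

variable (EB F E) in
/-- A Lie algebroid structure on the smooth vector bundle `E → M`. -/
structure LieAlgebroid where
  /-- the anchor `ρ : E → TM`, a smooth vector bundle map over the identity -/
  anchor : ∀ x : M, E x →ₗ[ℝ] TangentSpace 𝓘(ℝ, EB) x
  contMDiff_anchor : ContMDiff (𝓘(ℝ, EB).prod 𝓘(ℝ, F)) (𝓘(ℝ, EB).prod 𝓘(ℝ, EB)) ∞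
    (fun a : TotalSpace F E => (⟨a.proj, anchor a.proj a.2⟩ : TangentBundle 𝓘(ℝ, EB) M))
  /-- the Lie bracket of sections -/
  bracket : Cₛ^∞⟮𝓘(ℝ, EB); F, E⟯ →ₗ[ℝ] Cₛ^∞⟮𝓘(ℝ, EB); F, E⟯ →ₗ[ℝ] Cₛ^∞⟮𝓘(ℝ, EB); F, E⟯
  bracket_self : ∀ σ, bracket σ σ = 0
  jacobi : ∀ σ₁ σ₂ σ₃, bracket σ₁ (bracket σ₂ σ₃) + bracket σ₂ (bracket σ₃ σ₁)
    + bracket σ₃ (bracket σ₁ σ₂) = 0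
  /-- the compatibility condition `[σ, f η] = f [σ, η] + (ρ(σ) f) η` -/
  leibniz : ∀ σ (f : C^∞⟮𝓘(ℝ, EB), M; ℝ⟯) η x,
    bracket σ (smulSection f η) x = f x • bracket σ η x +
      differential 𝓘(ℝ, EB) f x (anchor x (σ x)) • η x

/-- The `E`-tangent bundle (prolongation) of a map `pr : P → M`: its fibre at `p` consists of the
pairs `(b, v)` with `b ∈ E_{pr p}`, `v ∈ T_p P` and `ρ(b) = T_p pr (v)`. -/
def LieAlgebroid.prolongation (A : LieAlgebroid EB F E)
    {EP : Type*} [NormedAddCommGroup EP] [NormedSpace ℝ EP] {HP : Type*} [TopologicalSpace HP]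
    (IP : ModelWithCorners ℝ EP HP) {P : Type*} [TopologicalSpace P] [ChartedSpace HP P]
    (pr : P → M) (p : P) : Submodule ℝ (E (pr p) × TangentSpace IP p) :=
  LinearMap.eqLocus (A.anchor (pr p) ∘ₗ LinearMap.fst ℝ _ _)
    ((mfderiv IP 𝓘(ℝ, EB) pr p).toLinearMap ∘ₗ LinearMap.snd ℝ _ _)

/-- The curve `t ↦ a + t b` in the fibre of `E` through `a`. -/
def fibreLine (a : TotalSpace F E) (b : E a.proj) : ℝ → TotalSpace F E :=
  fun t => ⟨a.proj, a.2 + t • b⟩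

variable (EB) in
/-- The vector `b_a^V ∈ T_a E` tangent to the curve `t ↦ a + t b` at `t = 0`. -/
def verticalVector (a : TotalSpace F E) (b : E a.proj) :
    TangentSpace (𝓘(ℝ, EB).prod 𝓘(ℝ, F)) a :=
  (mfderiv 𝓘(ℝ, ℝ) (𝓘(ℝ, EB).prod 𝓘(ℝ, F)) (fibreLine a b) 0 : ℝ →L[ℝ] EB × F) 1


theorem contMDiff_symm_fibre (x : M) : ContMDiff 𝓘(ℝ, F) (𝓘(ℝ, EB).prod 𝓘(ℝ, F)) ∞
    (fun w : F => (⟨x, (trivializationAt F E x).symm x w⟩ : TotalSpace F E)) := by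
  have h := (trivializationAt F E x).contMDiffOn_symm (n := ∞) (IB := 𝓘(ℝ, EB))
  have h2 : ContMDiff 𝓘(ℝ, F) (𝓘(ℝ, EB).prod 𝓘(ℝ, F)) ∞ (fun w : F => (x, w)) :=
    contMDiff_const.prodMk contMDiff_id
  have h3 := h.comp_contMDiff h2 (fun w => by
    rw [(trivializationAt F E x).mem_target]; exact FiberBundle.mem_baseSet_trivializationAt' x)
  refine h3.congr fun w => ?_
  exact ((trivializationAt F E x).mk_symm (FiberBundle.mem_baseSet_trivializationAt' x) w)

theorem fibreLine_eq (a : TotalSpace F E) (b : E a.proj) :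
    fibreLine a b = (fun w : F => (⟨a.proj, (trivializationAt F E a.proj).symm a.proj w⟩ :
      TotalSpace F E)) ∘ (fun t : ℝ =>
        (trivializationAt F E a.proj).continuousLinearMapAt ℝ a.proj a.2 +
        t • (trivializationAt F E a.proj).continuousLinearMapAt ℝ a.proj b) := by
  funext t
  have hx := FiberBundle.mem_baseSet_trivializationAt' (F := F) (E := E) a.proj
  simp only [Function.comp, ← map_smul, ← map_add]
  have := (trivializationAt F E a.proj).symmL_continuousLinearMapAt (R := ℝ) hx (a.2 + t • b)
  rw [Trivialization.symmL_apply _ hx] at this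
  rw [this]
  rfl

theorem contMDiff_fibreLine (a : TotalSpace F E) (b : E a.proj) :
    ContMDiff 𝓘(ℝ, ℝ) (𝓘(ℝ, EB).prod 𝓘(ℝ, F)) ∞ (fibreLine a b) := by
  rw [fibreLine_eq]
  refine (contMDiff_symm_fibre a.proj).comp ?_
  exact contMDiff_const.add (contMDiff_id.smul contMDiff_const)

theorem verticalVector_eq (a : TotalSpace F E) (b : E a.proj) :
    verticalVector EB a b = (mfderiv 𝓘(ℝ, F) (𝓘(ℝ, EB).prod 𝓘(ℝ, F))
      (fun w : F => (⟨a.proj, (trivializationAt F E a.proj).symm a.proj w⟩ : TotalSpace F E))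
      ((trivializationAt F E a.proj).continuousLinearMapAt ℝ a.proj a.2) : F →L[ℝ] EB × F)
      ((trivializationAt F E a.proj).continuousLinearMapAt ℝ a.proj b) := by
  have hn : (∞ : WithTop ℕ∞) ≠ 0 := by simp
  unfold verticalVector
  rw [fibreLine_eq]
  set wa := (trivializationAt F E a.proj).continuousLinearMapAt ℝ a.proj a.2
  set wb := (trivializationAt F E a.proj).continuousLinearMapAt ℝ a.proj b
  have hd : HasFDerivAt (fun t : ℝ => wa + t • wb) ((1 : ℝ →L[ℝ] ℝ).smulRight wb) 0 :=
    ((hasFDerivAt_id (𝕜 := ℝ) (0 : ℝ)).smul_const wb).const_add wa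
  have h0 : wa + (0 : ℝ) • wb = wa := by simp
  have h1 := (((contMDiff_symm_fibre (EB := EB) (F := F) (E := E) a.proj).mdifferentiable hn)
    (wa + (0 : ℝ) • wb)).hasMFDerivAt
  have := (HasMFDerivAt.comp (0 : ℝ) h1 hd.hasMFDerivAt).mfderiv
  refine (congrArg (fun T : ℝ →L[ℝ] EB × F => T 1) this).trans ?_
  change (mfderiv 𝓘(ℝ, F) (𝓘(ℝ, EB).prod 𝓘(ℝ, F))
      (fun w : F => (⟨a.proj, (trivializationAt F E a.proj).symm a.proj w⟩ : TotalSpace F E))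
      (wa + (0 : ℝ) • wb) : F →L[ℝ] EB × F) ((1 : ℝ) • wb) = _
  rw [one_smul, h0]


variable (EB) in
theorem verticalVector_add (a : TotalSpace F E) (b c : E a.proj) :
    verticalVector EB a (b + c) = verticalVector EB a b + verticalVector EB a c := by
  simp only [verticalVector_eq, map_add]
  exact ContinuousLinearMap.map_add (_ : F →L[ℝ] EB × F) _ _

variable (EB) in
theorem verticalVector_smul (a : TotalSpace F E) (r : ℝ) (b : E a.proj) :
    verticalVector EB a (r • b) = r • verticalVector EB a b := by
  simp only [verticalVector_eq, map_smul]
  exact ContinuousLinearMap.map_smul (_ : F →L[ℝ] EB × F) _ _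

/-- Vertical vectors project to zero. -/
theorem mfderiv_proj_verticalVector (a : TotalSpace F E) (b : E a.proj) :
    mfderiv (𝓘(ℝ, EB).prod 𝓘(ℝ, F)) 𝓘(ℝ, EB) (TotalSpace.proj : TotalSpace F E → M) a
      (verticalVector EB a b) = 0 := by
  have hn : (∞ : WithTop ℕ∞) ≠ 0 := by simp
  have h0 : fibreLine a b 0 = a := by simp [fibreLine]
  have h1 := ((Bundle.contMDiff_proj E (n := ∞) (F := F) (IB := 𝓘(ℝ, EB))).mdifferentiable hn
    (fibreLine a b 0)).hasMFDerivAt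
  have h2 := ((contMDiff_fibreLine (EB := EB) a b).mdifferentiable hn 0).hasMFDerivAt
  have h3 : HasMFDerivAt 𝓘(ℝ, ℝ) 𝓘(ℝ, EB) (fun _ : ℝ => a.proj) 0 0 := hasMFDerivAt_const _ _
  have h4 := hasMFDerivAt_unique (HasMFDerivAt.comp (0 : ℝ) h1 h2) h3
  have h5 := congrArg (fun T : ℝ →L[ℝ] EB => T 1) h4
  rw [h0] at h5
  exact h5

namespace LieAlgebroid
variable (A : LieAlgebroid EB F E)

/-- The prolongation `T^E E` of the Lie algebroid over itself, at the point `a ∈ E`. -/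
abbrev TEE (a : TotalSpace F E) :
    Submodule ℝ (E a.proj × TangentSpace (𝓘(ℝ, EB).prod 𝓘(ℝ, F)) a) :=
  A.prolongation (𝓘(ℝ, EB).prod 𝓘(ℝ, F)) TotalSpace.proj a

/-- The projection `T^E E → E`, `(a, b, v) ↦ b`. -/
def proj₂ (a : TotalSpace F E) : A.TEE a →ₗ[ℝ] E a.proj :=
  LinearMap.fst ℝ _ _ ∘ₗ (A.TEE a).subtype

/-- The anchor `ρ¹` of `T^E E`, `(a, b, v) ↦ v`. -/
def anchor₁ (a : TotalSpace F E) :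
    A.TEE a →ₗ[ℝ] TangentSpace (𝓘(ℝ, EB).prod 𝓘(ℝ, F)) a :=
  LinearMap.snd ℝ _ _ ∘ₗ (A.TEE a).subtype

/-- The vertical lift `ξ^V(a, b) = (a, 0, b_a^V)`. -/
def verticalLift (a : TotalSpace F E) : E a.proj →ₗ[ℝ] A.TEE a where
  toFun b := ⟨(0, verticalVector EB a b), by
    change A.anchor a.proj 0 = mfderiv (𝓘(ℝ, EB).prod 𝓘(ℝ, F)) 𝓘(ℝ, EB)
      (TotalSpace.proj : TotalSpace F E → M) a (verticalVector EB a b)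
    rw [mfderiv_proj_verticalVector, map_zero]⟩
  map_add' b c := by
    ext1
    exact Prod.ext (add_zero 0).symm (verticalVector_add EB a b c)
  map_smul' r b := by
    ext1
    exact Prod.ext (smul_zero r).symm (verticalVector_smul EB a r b)

/-- The vertical endomorphism `S(a, b, v) = ξ^V(a, b)`. -/
def S (a : TotalSpace F E) : A.TEE a →ₗ[ℝ] A.TEE a := A.verticalLift a ∘ₗ A.proj₂ a

/-- The Liouville section `Δ(a) = ξ^V(a, a)`. -/
def liouville (a : TotalSpace F E) : A.TEE a := A.verticalLift a a.2

/-- The differential on `T^E E` of a function `f` on `E`: `df(z) = ρ¹(z) f`. -/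
def d₀ (f : TotalSpace F E → ℝ) (a : TotalSpace F E) : A.TEE a →ₗ[ℝ] ℝ :=
  differential (𝓘(ℝ, EB).prod 𝓘(ℝ, F)) f a ∘ₗ A.anchor₁ a

/-- The energy `E_L = d_Δ L - L`. -/
def energy (L : TotalSpace F E → ℝ) (a : TotalSpace F E) : ℝ := A.d₀ L a (A.liouville a) - L a

/-- The Cartan `1`-form `θ_L = S^*(dL)`. -/
def cartanOneForm (L : TotalSpace F E → ℝ) (a : TotalSpace F E) : A.TEE a →ₗ[ℝ] ℝ :=
  A.d₀ L a ∘ₗ A.S a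


/-- The function `θ_L(Z)` on `E`, for any section `Z` of `T^E E` that projects to the section `σ`
of `E`. -/
def pairing (L : TotalSpace F E → ℝ) (σ : Cₛ^∞⟮𝓘(ℝ, EB); F, E⟯) (a : TotalSpace F E) : ℝ :=
  A.d₀ L a (A.verticalLift a (σ a.proj))

theorem pairing_eq_deriv {L : TotalSpace F E → ℝ}
    (hL : ContMDiff (𝓘(ℝ, EB).prod 𝓘(ℝ, F)) 𝓘(ℝ, ℝ) ∞ L) (σ : Cₛ^∞⟮𝓘(ℝ, EB); F, E⟯)
    (a : TotalSpace F E) :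
    A.pairing L σ a = (mfderiv 𝓘(ℝ, ℝ) 𝓘(ℝ, ℝ)
      (fun t : ℝ => L (⟨a.proj, a.2 + t • σ a.proj⟩ : TotalSpace F E)) 0 : ℝ →L[ℝ] ℝ) 1 := by
  have hn : (∞ : WithTop ℕ∞) ≠ 0 := by simp
  have h0 : fibreLine a (σ a.proj) 0 = a := by simp [fibreLine]
  have h2 := ((contMDiff_fibreLine (EB := EB) a (σ a.proj)).mdifferentiable hn 0).hasMFDerivAt
  have h1 := (hL.mdifferentiable hn (fibreLine a (σ a.proj) 0)).hasMFDerivAt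
  have h3 := congrArg (fun T : ℝ →L[ℝ] ℝ => T 1) (HasMFDerivAt.comp (0 : ℝ) h1 h2).mfderiv
  refine Eq.trans ?_ h3.symm
  rw [h0]
  rfl

theorem contMDiff_add_smul (σ : Cₛ^∞⟮𝓘(ℝ, EB); F, E⟯) :
    ContMDiff ((𝓘(ℝ, EB).prod 𝓘(ℝ, F)).prod 𝓘(ℝ, ℝ)) (𝓘(ℝ, EB).prod 𝓘(ℝ, F)) ∞
      (fun q : TotalSpace F E × ℝ =>
        (⟨q.1.proj, q.1.2 + q.2 • σ q.1.proj⟩ : TotalSpace F E)) := by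
  intro q₀
  have hid : ContMDiffAt ((𝓘(ℝ, EB).prod 𝓘(ℝ, F)).prod 𝓘(ℝ, ℝ)) (𝓘(ℝ, EB).prod 𝓘(ℝ, F)) ∞
    (fun q : TotalSpace F E × ℝ => q.1) q₀ := contMDiffAt_fst
  have h1 := contMDiffAt_totalSpace.1 hid
  have h2 : ContMDiffAt ((𝓘(ℝ, EB).prod 𝓘(ℝ, F)).prod 𝓘(ℝ, ℝ)) 𝓘(ℝ, F) ∞
      (fun q : TotalSpace F E × ℝ => (trivializationAt F E q₀.1.proj
        (⟨q.1.proj, σ q.1.proj⟩ : TotalSpace F E)).2) q₀ :=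
    (contMDiffAt_totalSpace.1 ((σ.contMDiff q₀.1.proj).comp q₀ h1.1)).2
  refine contMDiffAt_totalSpace.2 ⟨h1.1, ?_⟩
  have h3 := h1.2.add ((contMDiffAt_snd : ContMDiffAt ((𝓘(ℝ, EB).prod 𝓘(ℝ, F)).prod 𝓘(ℝ, ℝ))
    𝓘(ℝ, ℝ) ∞ (fun q : TotalSpace F E × ℝ => q.2) q₀).smul h2)
  refine h3.congr_of_eventuallyEq ?_
  have ho : {q : TotalSpace F E × ℝ | q.1.proj ∈ (trivializationAt F E q₀.1.proj).baseSet} ∈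
      𝓝 q₀ := h1.1.continuousAt.preimage_mem_nhds
    ((trivializationAt F E q₀.1.proj).open_baseSet.mem_nhds
      (FiberBundle.mem_baseSet_trivializationAt' _))
  filter_upwards [ho] with q hq
  have hl := (trivializationAt F E q₀.1.proj).linear ℝ hq
  exact (hl.map_add _ _).trans (congrArg _ (hl.map_smul _ _))

theorem contMDiff_pairing {L : TotalSpace F E → ℝ}
    (hL : ContMDiff (𝓘(ℝ, EB).prod 𝓘(ℝ, F)) 𝓘(ℝ, ℝ) ∞ L) (σ : Cₛ^∞⟮𝓘(ℝ, EB); F, E⟯) :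
    ContMDiff (𝓘(ℝ, EB).prod 𝓘(ℝ, F)) 𝓘(ℝ, ℝ) ∞ (A.pairing L σ) := by
  intro a
  have h := ContMDiffAt.mfderiv (J := 𝓘(ℝ, EB).prod 𝓘(ℝ, F)) (I := 𝓘(ℝ, ℝ)) (I' := 𝓘(ℝ, ℝ))
    (m := ∞) (n := ∞) (x₀ := a)
    (fun (a : TotalSpace F E) (t : ℝ) => L (⟨a.proj, a.2 + t • σ a.proj⟩ : TotalSpace F E))
    (fun _ => (0 : ℝ)) ((hL.comp (contMDiff_add_smul σ)) (a, 0)) contMDiffAt_const (by simp)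
  let φ : TotalSpace F E → (ℝ →L[ℝ] ℝ) := fun a => mfderiv 𝓘(ℝ, ℝ) 𝓘(ℝ, ℝ)
    (fun t : ℝ => L (⟨a.proj, a.2 + t • σ a.proj⟩ : TotalSpace F E)) 0
  have h1 : ContMDiffAt (𝓘(ℝ, EB).prod 𝓘(ℝ, F)) 𝓘(ℝ, ℝ →L[ℝ] ℝ) ∞ φ a := by
    rw [← inTangentCoordinates_model_space (I := 𝓘(ℝ, ℝ)) (I' := 𝓘(ℝ, ℝ))
      (fun _ : TotalSpace F E => (0 : ℝ))
      (fun a => L (⟨a.proj, a.2 + (0 : ℝ) • σ a.proj⟩ : TotalSpace F E)) φ a]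
    exact h
  have h2 := h1.clm_apply (contMDiffAt_const (c := (1 : ℝ)))
  refine h2.congr_of_eventuallyEq (Filter.Eventually.of_forall fun a' => ?_)
  exact A.pairing_eq_deriv hL σ a'

end LieAlgebroid

variable [FiniteDimensional ℝ EB] [T2Space M]

variable (EB F E) in
/-- A smooth bump function at `x`, supported in the domain of a trivialization of `E` around `x`. -/
def bump (x : M) : SmoothBumpFunction 𝓘(ℝ, EB) x :=
  ((SmoothBumpFunction.nhds_basis_tsupport (I := 𝓘(ℝ, EB)) x).mem_iff.1
    ((trivializationAt F E x).open_baseSet.mem_nhds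
      (FiberBundle.mem_baseSet_trivializationAt' x))).choose

variable (EB F E) in
theorem tsupport_bump (x : M) : tsupport (bump EB F E x) ⊆ (trivializationAt F E x).baseSet :=
  ((SmoothBumpFunction.nhds_basis_tsupport (I := 𝓘(ℝ, EB)) x).mem_iff.1
    ((trivializationAt F E x).open_baseSet.mem_nhds
      (FiberBundle.mem_baseSet_trivializationAt' x))).choose_spec.2

variable (EB F E) in
/-- The global section of `E` which has the constant coordinates `w` near `x`, in the preferred
trivialization at `x`. -/
def frameSection (x : M) : F →ₗ[ℝ] Cₛ^∞⟮𝓘(ℝ, EB); F, E⟯ where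
  toFun w := ⟨fun y => bump EB F E x y • (trivializationAt F E x).symmL ℝ y w, by
    refine ContMDiffOn.smul_section_of_tsupport (u := (trivializationAt F E x).baseSet)
      (bump EB F E x).contMDiff.contMDiffOn (trivializationAt F E x).open_baseSet
      (tsupport_bump EB F E x) ?_
    rw [(trivializationAt F E x).contMDiffOn_section_baseSet_iff]
    refine (contMDiffOn_const (c := w)).congr fun y hy => ?_
    simp [hy]⟩
  map_add' b c := by
    ext y
    exact (congrArg _ (map_add _ _ _)).trans (smul_add _ _ _)
  map_smul' r b := by
    ext y
    exact (congrArg _ (map_smul _ _ _)).trans (smul_comm _ _ _)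

variable (EB F E) in
/-- A global smooth section of `E` through the vector `b ∈ E_x`, depending linearly on `b`. -/
def extendSection (x : M) : E x →ₗ[ℝ] Cₛ^∞⟮𝓘(ℝ, EB); F, E⟯ :=
  frameSection EB F E x ∘ₗ ((trivializationAt F E x).continuousLinearMapAt ℝ x).toLinearMap

theorem extendSection_apply_self (x : M) (b : E x) : extendSection EB F E x b x = b := by
  have hx := FiberBundle.mem_baseSet_trivializationAt' (F := F) (E := E) x
  change bump EB F E x x • (trivializationAt F E x).symmL ℝ x
    ((trivializationAt F E x).continuousLinearMapAt ℝ x b) = b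
  rw [Trivialization.symmL_continuousLinearMapAt _ hx, SmoothBumpFunction.eq_one, one_smul]

namespace LieAlgebroid
variable (A : LieAlgebroid EB F E)

variable (L : C^∞⟮𝓘(ℝ, EB).prod 𝓘(ℝ, F), TotalSpace F E; ℝ⟯)

/-- For sections `Z₁`, `Z₂` of `T^E E` that project to the sections `σ₁`, `σ₂` of `E` and whose
anchors at `a` are `v₁`, `v₂`: the value at `a` of
`-dθ_L(Z₁, Z₂) = -(ρ¹(Z₁) θ_L(Z₂) - ρ¹(Z₂) θ_L(Z₁) - θ_L([Z₁, Z₂]))`. Here `θ_L(Zᵢ)` is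
`pairing L σᵢ`, and `θ_L([Z₁, Z₂])` is `pairing L [σ₁, σ₂]` because `[Z₁, Z₂]` projects to
`[σ₁, σ₂]`. -/
def negDTheta (a : TotalSpace F E) (σ₁ σ₂ : Cₛ^∞⟮𝓘(ℝ, EB); F, E⟯)
    (v₁ v₂ : TangentSpace (𝓘(ℝ, EB).prod 𝓘(ℝ, F)) a) : ℝ :=
  -(differential (𝓘(ℝ, EB).prod 𝓘(ℝ, F)) (A.pairing L σ₂) a v₁
    - differential (𝓘(ℝ, EB).prod 𝓘(ℝ, F)) (A.pairing L σ₁) a v₂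
    - A.pairing L (A.bracket σ₁ σ₂) a)

theorem pairing_add (σ η : Cₛ^∞⟮𝓘(ℝ, EB); F, E⟯) :
    A.pairing L (σ + η) = A.pairing L σ + A.pairing L η := by
  funext a
  simp [pairing]

theorem pairing_smul (r : ℝ) (σ : Cₛ^∞⟮𝓘(ℝ, EB); F, E⟯) :
    A.pairing L (r • σ) = r • A.pairing L σ := by
  funext a
  simp [pairing]

theorem pairing_smulSection (f : C^∞⟮𝓘(ℝ, EB), M; ℝ⟯)
    (σ : Cₛ^∞⟮𝓘(ℝ, EB); F, E⟯) :
    A.pairing L (smulSection f σ) = fun a => f a.proj * A.pairing L σ a := by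
  funext a
  simp [pairing, smulSection]

theorem mdifferentiableAt_pairing (σ : Cₛ^∞⟮𝓘(ℝ, EB); F, E⟯) (a : TotalSpace F E) :
    MDifferentiableAt (𝓘(ℝ, EB).prod 𝓘(ℝ, F)) 𝓘(ℝ, ℝ) (A.pairing L σ) a :=
  (A.contMDiff_pairing L.contMDiff σ).mdifferentiable (by simp) a

theorem differential_pairing_add (σ η : Cₛ^∞⟮𝓘(ℝ, EB); F, E⟯) (a : TotalSpace F E) :
    differential (𝓘(ℝ, EB).prod 𝓘(ℝ, F)) (A.pairing L (σ + η)) a =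
      differential (𝓘(ℝ, EB).prod 𝓘(ℝ, F)) (A.pairing L σ) a +
      differential (𝓘(ℝ, EB).prod 𝓘(ℝ, F)) (A.pairing L η) a := by
  rw [pairing_add]
  ext v
  exact congrArg (fun T : EB × F →L[ℝ] ℝ => T v)
    (mfderiv_add (A.mdifferentiableAt_pairing L σ a) (A.mdifferentiableAt_pairing L η a))

theorem differential_pairing_smul (r : ℝ) (σ : Cₛ^∞⟮𝓘(ℝ, EB); F, E⟯) (a : TotalSpace F E) :
    differential (𝓘(ℝ, EB).prod 𝓘(ℝ, F)) (A.pairing L (r • σ)) a =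
      r • differential (𝓘(ℝ, EB).prod 𝓘(ℝ, F)) (A.pairing L σ) a := by
  rw [pairing_smul]
  ext v
  exact congrArg (fun T : EB × F →L[ℝ] ℝ => T v)
    (const_smul_mfderiv (A.mdifferentiableAt_pairing L σ a) r)

theorem negDTheta_add_left (a : TotalSpace F E) (σ σ' η : Cₛ^∞⟮𝓘(ℝ, EB); F, E⟯)
    (v v' w : TangentSpace (𝓘(ℝ, EB).prod 𝓘(ℝ, F)) a) :
    A.negDTheta L a (σ + σ') η (v + v') w =
      A.negDTheta L a σ η v w + A.negDTheta L a σ' η v' w := by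
  simp only [negDTheta, map_add, LinearMap.add_apply, differential_pairing_add]
  simp only [pairing_add, Pi.add_apply]
  ring

theorem negDTheta_smul_left (a : TotalSpace F E) (r : ℝ) (σ η : Cₛ^∞⟮𝓘(ℝ, EB); F, E⟯)
    (v w : TangentSpace (𝓘(ℝ, EB).prod 𝓘(ℝ, F)) a) :
    A.negDTheta L a (r • σ) η (r • v) w = r * A.negDTheta L a σ η v w := by
  simp only [negDTheta, map_smul, LinearMap.smul_apply, differential_pairing_smul]
  simp only [pairing_smul, Pi.smul_apply, smul_eq_mul]
  ring

theorem bracket_swap (σ η : Cₛ^∞⟮𝓘(ℝ, EB); F, E⟯) : A.bracket σ η = -A.bracket η σ := by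
  have h := A.bracket_self (σ + η)
  simp only [map_add, LinearMap.add_apply, A.bracket_self, zero_add, add_zero] at h
  exact eq_neg_of_add_eq_zero_right h

theorem negDTheta_swap (a : TotalSpace F E) (σ η : Cₛ^∞⟮𝓘(ℝ, EB); F, E⟯)
    (v w : TangentSpace (𝓘(ℝ, EB).prod 𝓘(ℝ, F)) a) :
    A.negDTheta L a σ η v w = -A.negDTheta L a η σ w v := by
  have h := A.pairing_smul L (-1) (A.bracket η σ)
  rw [neg_one_smul, ← bracket_swap] at h
  simp only [negDTheta, h, Pi.smul_apply, smul_eq_mul]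
  ring

/-- The Cartan `2`-form `ω_L = -dθ_L`, evaluated through sections of `E` that extend the two
projections; `cartanTwoForm_eq` shows that all extensions give the same value. -/
def cartanTwoForm (a : TotalSpace F E) : A.TEE a →ₗ[ℝ] A.TEE a →ₗ[ℝ] ℝ :=
  LinearMap.mk₂ ℝ (fun z₁ z₂ => A.negDTheta L a
      (extendSection EB F E a.proj (A.proj₂ a z₁)) (extendSection EB F E a.proj (A.proj₂ a z₂))
      (A.anchor₁ a z₁) (A.anchor₁ a z₂))
    (fun z z' w => by
      simp only [map_add, negDTheta_add_left])
    (fun r z w => by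
      simp only [map_smul, negDTheta_smul_left, smul_eq_mul])
    (fun z w w' => by
      rw [negDTheta_swap]
      simp only [map_add, negDTheta_add_left, neg_add, ← negDTheta_swap])
    (fun r z w => by
      rw [negDTheta_swap]
      simp only [map_smul, negDTheta_smul_left, smul_eq_mul, ← mul_neg, ← negDTheta_swap])

/-- Pairing and bracket have the same derivation property, with respect to the multiplication by
functions on the base. -/
theorem pairing_leibniz (a : TotalSpace F E) (σ η : Cₛ^∞⟮𝓘(ℝ, EB); F, E⟯)
    (f : C^∞⟮𝓘(ℝ, EB), M; ℝ⟯) (v : TangentSpace (𝓘(ℝ, EB).prod 𝓘(ℝ, F)) a)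
    (hv : A.anchor a.proj (σ a.proj) =
      mfderiv (𝓘(ℝ, EB).prod 𝓘(ℝ, F)) 𝓘(ℝ, EB) (TotalSpace.proj : TotalSpace F E → M) a v) :
    differential (𝓘(ℝ, EB).prod 𝓘(ℝ, F)) (A.pairing L (smulSection f η)) a v
      - A.pairing L (A.bracket σ (smulSection f η)) a =
    f a.proj * (differential (𝓘(ℝ, EB).prod 𝓘(ℝ, F)) (A.pairing L η) a v
      - A.pairing L (A.bracket σ η) a) := by
  have hn : (∞ : WithTop ℕ∞) ≠ 0 := by simp
  have h1 : A.pairing L (A.bracket σ (smulSection f η)) a =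
      f a.proj * A.pairing L (A.bracket σ η) a +
      differential 𝓘(ℝ, EB) f a.proj (A.anchor a.proj (σ a.proj)) * A.pairing L η a := by
    unfold pairing
    rw [A.leibniz]
    simp
  have hf := (f.contMDiff.mdifferentiable hn a.proj).hasMFDerivAt
  have hp := ((Bundle.contMDiff_proj E (n := ∞) (F := F) (IB := 𝓘(ℝ, EB))).mdifferentiable hn
    a).hasMFDerivAt
  have hg := (A.mdifferentiableAt_pairing L η a).hasMFDerivAt
  have h2 := (HasMFDerivAt.mul (HasMFDerivAt.comp a hf hp) hg).mfderiv
  have h3 : differential (𝓘(ℝ, EB).prod 𝓘(ℝ, F)) (A.pairing L (smulSection f η)) a v =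
      f a.proj * differential (𝓘(ℝ, EB).prod 𝓘(ℝ, F)) (A.pairing L η) a v +
      A.pairing L η a * differential 𝓘(ℝ, EB) f a.proj (mfderiv (𝓘(ℝ, EB).prod 𝓘(ℝ, F)) 𝓘(ℝ, EB)
        (TotalSpace.proj : TotalSpace F E → M) a v) := by
    rw [pairing_smulSection]
    exact congrArg (fun T : EB × F →L[ℝ] ℝ => T v) h2
  rw [h1, h3, hv]
  ring

end LieAlgebroid

/-- A functional on sections that is linear over the functions, at the point `x`, vanishes on the
sections that vanish at `x`. -/
theorem eq_zero_of_tensorial [FiniteDimensional ℝ F] (x : M)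
    (D : Cₛ^∞⟮𝓘(ℝ, EB); F, E⟯ →+ ℝ)
    (hD : ∀ (f : C^∞⟮𝓘(ℝ, EB), M; ℝ⟯) η, D (smulSection f η) = f x * D η)
    (η : Cₛ^∞⟮𝓘(ℝ, EB); F, E⟯) (hη : η x = 0) : D η = 0 := by
  set e := trivializationAt F E x with he
  have hx : x ∈ e.baseSet := FiberBundle.mem_baseSet_trivializationAt' x
  let β := Module.finBasis ℝ F
  let ψ : C^∞⟮𝓘(ℝ, EB), M; ℝ⟯ := ⟨bump EB F E x, (bump EB F E x).contMDiff⟩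
  have hψx : ψ x = 1 := SmoothBumpFunction.eq_one _
  have hg : ∀ i, ContMDiff 𝓘(ℝ, EB) 𝓘(ℝ, ℝ) ∞
      (fun y => bump EB F E x y * β.coord i (e.continuousLinearMapAt ℝ y (η y))) := by
    intro i
    have h1 : ContMDiffOn 𝓘(ℝ, EB) 𝓘(ℝ, F) ∞
        (fun y => e.continuousLinearMapAt ℝ y (η y)) e.baseSet := by
      have := (e.contMDiffOn_section_baseSet_iff).1
        (η.contMDiff.contMDiffOn (s := e.baseSet))
      refine this.congr fun y hy => ?_
      simp [Trivialization.coe_linearMapAt_of_mem _ hy]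
    have h2 : ContMDiffOn 𝓘(ℝ, EB) 𝓘(ℝ, ℝ) ∞
        (fun y => β.coord i (e.continuousLinearMapAt ℝ y (η y))) e.baseSet :=
      (LinearMap.toContinuousLinearMap (β.coord i)).contMDiff.comp_contMDiffOn h1
    refine contMDiff_of_tsupport fun y hy => ?_
    have hy' : y ∈ e.baseSet :=
      tsupport_bump EB F E x (tsupport_mul_subset_left hy)
    exact ((bump EB F E x).contMDiff y).mul (h2.contMDiffAt (e.open_baseSet.mem_nhds hy'))
  let g : ∀ _ : Fin (Module.finrank ℝ F), C^∞⟮𝓘(ℝ, EB), M; ℝ⟯ := fun i => ⟨_, hg i⟩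
  have hgx : ∀ i, g i x = 0 := by
    intro i
    change bump EB F E x x * β.coord i (e.continuousLinearMapAt ℝ x (η x)) = 0
    simp [hη]
  have hsum : smulSection ψ (smulSection ψ η) =
      ∑ i, smulSection (g i) (frameSection EB F E x (β i)) := by
    ext y
    have hs : (∑ i, smulSection (g i) (frameSection EB F E x (β i))) y =
        ∑ i, (smulSection (g i) (frameSection EB F E x (β i))) y := by
      have h5 := map_sum (ContMDiffSection.coeAddHom 𝓘(ℝ, EB) F ∞ E)
        (fun i => smulSection (g i) (frameSection EB F E x (β i))) Finset.univ
      exact (congrFun h5 y).trans (Finset.sum_apply _ _ _)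
    rw [hs]
    change bump EB F E x y • bump EB F E x y • η y =
      ∑ i, (bump EB F E x y * β.coord i (e.continuousLinearMapAt ℝ y (η y))) •
        bump EB F E x y • e.symmL ℝ y (β i)
    by_cases hy : y ∈ e.baseSet
    · have h3 : η y = ∑ i, β.coord i (e.continuousLinearMapAt ℝ y (η y)) • e.symmL ℝ y (β i) := by
        conv_lhs => rw [← e.symmL_continuousLinearMapAt (R := ℝ) hy (η y),
          ← β.sum_repr (e.continuousLinearMapAt ℝ y (η y)), map_sum]
        simp only [map_smul, Module.Basis.coord_apply]
      conv_lhs => rw [h3]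
      simp only [Finset.smul_sum, smul_smul]
      refine Finset.sum_congr rfl fun i _ => ?_
      congr 1
      ring
    · have h0 : bump EB F E x y = 0 := by
        by_contra h
        exact hy (tsupport_bump EB F E x (subset_tsupport _ h))
      simp [h0]
  have h4 : D (smulSection ψ (smulSection ψ η)) = D η := by simp [hD, hψx]
  rw [← h4, hsum, map_sum]
  exact Finset.sum_eq_zero fun i _ => by rw [hD, hgx, zero_mul]

namespace LieAlgebroid
variable (A : LieAlgebroid EB F E) (L : C^∞⟮𝓘(ℝ, EB).prod 𝓘(ℝ, F), TotalSpace F E; ℝ⟯)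

theorem negDTheta_congr_right [FiniteDimensional ℝ F] (a : TotalSpace F E)
    {σ η η' : Cₛ^∞⟮𝓘(ℝ, EB); F, E⟯} {v w : TangentSpace (𝓘(ℝ, EB).prod 𝓘(ℝ, F)) a}
    (hv : A.anchor a.proj (σ a.proj) =
      mfderiv (𝓘(ℝ, EB).prod 𝓘(ℝ, F)) 𝓘(ℝ, EB) (TotalSpace.proj : TotalSpace F E → M) a v)
    (h : η a.proj = η' a.proj) : A.negDTheta L a σ η v w = A.negDTheta L a σ η' v w := by
  let D : Cₛ^∞⟮𝓘(ℝ, EB); F, E⟯ →+ ℝ :=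
    { toFun := fun ζ => differential (𝓘(ℝ, EB).prod 𝓘(ℝ, F)) (A.pairing L ζ) a v
        - A.pairing L (A.bracket σ ζ) a
      map_zero' := by
        have := A.pairing_leibniz L a σ 0 0 v hv
        have h0 : smulSection (0 : C^∞⟮𝓘(ℝ, EB), M; ℝ⟯) (0 : Cₛ^∞⟮𝓘(ℝ, EB); F, E⟯) = 0 := by
          ext y
          simp [smulSection]
        rw [h0] at this
        simpa using this
      map_add' := fun ζ ζ' => by
        simp only [differential_pairing_add, map_add, LinearMap.add_apply]
        simp only [pairing_add, Pi.add_apply]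
        ring }
  have h1 : D (η - η') = 0 := eq_zero_of_tensorial a.proj D
    (fun f ζ => A.pairing_leibniz L a σ ζ f v hv) _ (by simp [h])
  rw [map_sub, sub_eq_zero] at h1
  have h2 : differential (𝓘(ℝ, EB).prod 𝓘(ℝ, F)) (A.pairing L η) a v
        - A.pairing L (A.bracket σ η) a = differential (𝓘(ℝ, EB).prod 𝓘(ℝ, F)) (A.pairing L η') a v
        - A.pairing L (A.bracket σ η') a := h1
  simp only [negDTheta]
  linarith

/-- `ω_L(Z₁, Z₂) = -(ρ¹(Z₁) θ_L(Z₂) - ρ¹(Z₂) θ_L(Z₁) - θ_L([Z₁, Z₂]))` for all sections `Z₁`, `Z₂`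
of `T^E E` that project to sections `σ₁`, `σ₂` of `E`. -/
theorem cartanTwoForm_eq [FiniteDimensional ℝ F] (a : TotalSpace F E) (z₁ z₂ : A.TEE a)
    (σ₁ σ₂ : Cₛ^∞⟮𝓘(ℝ, EB); F, E⟯) (h₁ : σ₁ a.proj = A.proj₂ a z₁)
    (h₂ : σ₂ a.proj = A.proj₂ a z₂) :
    A.cartanTwoForm L a z₁ z₂ = A.negDTheta L a σ₁ σ₂ (A.anchor₁ a z₁) (A.anchor₁ a z₂) := by
  have e₁ := extendSection_apply_self (EB := EB) (F := F) a.proj (A.proj₂ a z₁)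
  have e₂ := extendSection_apply_self (EB := EB) (F := F) a.proj (A.proj₂ a z₂)
  change A.negDTheta L a _ _ _ _ = _
  rw [A.negDTheta_congr_right L a (η' := σ₂) (by rw [e₁]; exact z₁.2) (e₂.trans h₂.symm),
    negDTheta_swap, A.negDTheta_congr_right L a (η' := σ₁) (by rw [h₂]; exact z₂.2)
      (e₁.trans h₁.symm), ← negDTheta_swap]

/-- The Lagrangian `L` is regular if `ω_L` is nondegenerate at every point. -/
def IsRegularLagrangian : Prop := ∀ a, (A.cartanTwoForm L a).Nondegenerate

theorem proj₂_surjective (a : TotalSpace F E) : Function.Surjective (A.proj₂ a) := by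
  intro b
  have hn : (∞ : WithTop ℕ∞) ≠ 0 := by simp
  let σ := extendSection EB F E a.proj a.2
  have h0 : (⟨a.proj, σ a.proj⟩ : TotalSpace F E) = a := by
    rw [show σ a.proj = a.2 from extendSection_apply_self _ _]
  have hp := ((Bundle.contMDiff_proj E (n := ∞) (F := F) (IB := 𝓘(ℝ, EB))).mdifferentiable hn
    (⟨a.proj, σ a.proj⟩ : TotalSpace F E)).hasMFDerivAt
  have hs := (σ.contMDiff.mdifferentiable hn a.proj).hasMFDerivAt
  have h := hasMFDerivAt_unique (HasMFDerivAt.comp a.proj hp hs) (hasMFDerivAt_id a.proj)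
  have h1 := congrArg (fun T : EB →L[ℝ] EB => T (A.anchor a.proj b)) h
  rw [h0] at h1
  exact ⟨⟨(b, (mfderiv 𝓘(ℝ, EB) (𝓘(ℝ, EB).prod 𝓘(ℝ, F))
    (fun x => (⟨x, σ x⟩ : TotalSpace F E)) a.proj : EB →L[ℝ] EB × F) (A.anchor a.proj b)),
    h1.symm⟩, rfl⟩

/-- A linear choice `b ↦ bt` of elements of `T^E_a E` with projection `b`. -/
def lift (a : TotalSpace F E) : E a.proj →ₗ[ℝ] A.TEE a :=
  ((A.proj₂ a).exists_rightInverse_of_surjective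
    (LinearMap.range_eq_top.2 (A.proj₂_surjective a))).choose

theorem proj₂_lift (a : TotalSpace F E) (b : E a.proj) : A.proj₂ a (A.lift a b) = b :=
  LinearMap.congr_fun ((A.proj₂ a).exists_rightInverse_of_surjective
    (LinearMap.range_eq_top.2 (A.proj₂_surjective a))).choose_spec b

/-- The tensor `G^L_a(b, c) = ω_L(bt, c_a^V)`, where `bt` projects to `b`; `tensorG_eq` shows
that all `bt` give the same value. -/
def tensorG (a : TotalSpace F E) : E a.proj →ₗ[ℝ] E a.proj →ₗ[ℝ] ℝ :=
  (A.cartanTwoForm L a).compl₁₂ (A.lift a) (A.verticalLift a)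

theorem tensorG_eq (a : TotalSpace F E) (z : A.TEE a) (c : E a.proj) :
    A.tensorG L a (A.proj₂ a z) c = A.cartanTwoForm L a z (A.verticalLift a c) := by
  have hv : ∀ z w : A.TEE a, A.proj₂ a z = 0 → A.proj₂ a w = 0 →
      A.cartanTwoForm L a z w = 0 := by
    intro z w hz hw
    have hp : A.pairing L (0 : Cₛ^∞⟮𝓘(ℝ, EB); F, E⟯) a = 0 := by
      have := congrFun (A.pairing_smul L 0 0) a
      simpa using this
    have hd := A.differential_pairing_smul L 0 0 a
    simp only [zero_smul] at hd
    change A.negDTheta L a _ _ _ _ = _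
    rw [hz, hw, map_zero]
    simp only [negDTheta, hd, map_zero, LinearMap.zero_apply, hp, sub_zero, neg_zero]
  change A.cartanTwoForm L a (A.lift a (A.proj₂ a z)) (A.verticalLift a c) = _
  rw [← sub_eq_zero, ← LinearMap.sub_apply, ← map_sub]
  exact hv _ _ (by rw [map_sub, proj₂_lift, sub_self]) rfl

end LieAlgebroid

variable (EB F E) in
/-- A submanifold of `E`, given as the image of an embedding `P → E` of a manifold `P`, such that
the restriction `P → M` of the bundle projection is a fibration (a surjective submersion). -/
structure ConstraintSubmanifold (EP : Type*) [NormedAddCommGroup EP] [NormedSpace ℝ EP]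
    (P : Type*) [TopologicalSpace P] [ChartedSpace EP P] where
  /-- the inclusion of the submanifold into `E` -/
  incl : P → TotalSpace F E
  contMDiff_incl : ContMDiff 𝓘(ℝ, EP) (𝓘(ℝ, EB).prod 𝓘(ℝ, F)) ∞ incl
  isEmbedding_incl : Topology.IsEmbedding incl
  injective_mfderiv_incl : ∀ p, Function.Injective
    (mfderiv 𝓘(ℝ, EP) (𝓘(ℝ, EB).prod 𝓘(ℝ, F)) incl p)
  surjective_proj : Function.Surjective fun p => (incl p).proj
  surjective_mfderiv_proj : ∀ p, Function.Surjective
    (mfderiv 𝓘(ℝ, EP) 𝓘(ℝ, EB) (fun p => (incl p).proj) p)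

namespace ConstraintSubmanifold
variable {EP : Type*} [NormedAddCommGroup EP] [NormedSpace ℝ EP]
  {P : Type*} [TopologicalSpace P] [ChartedSpace EP P] [IsManifold 𝓘(ℝ, EP) ∞ P]
  (N : ConstraintSubmanifold EB F E EP P)
  (A : LieAlgebroid EB F E) (L : C^∞⟮𝓘(ℝ, EB).prod 𝓘(ℝ, F), TotalSpace F E; ℝ⟯)

/-- The fibration `P → M`. -/
def pr (p : P) : M := (N.incl p).proj

/-- The prolongation `T^E P` of the fibration `P → M`, at `p`. -/
abbrev TEP (p : P) : Submodule ℝ (E (N.pr p) × TangentSpace 𝓘(ℝ, EP) p) :=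
  A.prolongation 𝓘(ℝ, EP) N.pr p

theorem mfderiv_pr (p : P) (v : TangentSpace 𝓘(ℝ, EP) p) :
    mfderiv 𝓘(ℝ, EP) 𝓘(ℝ, EB) N.pr p v =
      mfderiv (𝓘(ℝ, EB).prod 𝓘(ℝ, F)) 𝓘(ℝ, EB) (TotalSpace.proj : TotalSpace F E → M) (N.incl p)
        (mfderiv 𝓘(ℝ, EP) (𝓘(ℝ, EB).prod 𝓘(ℝ, F)) N.incl p v) := by
  have hn : (∞ : WithTop ℕ∞) ≠ 0 := by simp
  have h1 := ((Bundle.contMDiff_proj E (n := ∞) (F := F) (IB := 𝓘(ℝ, EB))).mdifferentiable hn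
    (N.incl p)).hasMFDerivAt
  have h2 := (N.contMDiff_incl.mdifferentiable hn p).hasMFDerivAt
  exact congrArg (fun T : EP →L[ℝ] EB => T v) (HasMFDerivAt.comp p h1 h2).mfderiv

/-- The inclusion `T^E P → T^E E` over `P → E`, `(b, v) ↦ (b, T(incl)(v))`. -/
def inclusion (p : P) : N.TEP A p →ₗ[ℝ] A.TEE (N.incl p) :=
  LinearMap.codRestrict (A.TEE (N.incl p))
    ((LinearMap.prodMap LinearMap.id
      (mfderiv 𝓘(ℝ, EP) (𝓘(ℝ, EB).prod 𝓘(ℝ, F)) N.incl p).toLinearMap :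
        E (N.pr p) × TangentSpace 𝓘(ℝ, EP) p →ₗ[ℝ]
          E (N.pr p) × TangentSpace (𝓘(ℝ, EB).prod 𝓘(ℝ, F)) (N.incl p)) ∘ₗ (N.TEP A p).subtype)
    (fun z => (show A.anchor (N.pr p) z.1.1 = _ from z.2).trans (N.mfderiv_pr p z.1.2))

/-- `T^E_p P`, as a subspace of `T^E E`. -/
def TE (p : P) : Submodule ℝ (A.TEE (N.incl p)) := LinearMap.range (N.inclusion A p)

/-- The space `V_p = {b ∈ E | b_a^V is tangent to the submanifold}`, `a = incl p`, of virtual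
displacements. -/
def V (p : P) : Submodule ℝ (E (N.incl p).proj) where
  carrier := {b | ∃ v : TangentSpace 𝓘(ℝ, EP) p,
    mfderiv 𝓘(ℝ, EP) (𝓘(ℝ, EB).prod 𝓘(ℝ, F)) N.incl p v = verticalVector EB (N.incl p) b}
  zero_mem' := ⟨0, by
    have := verticalVector_smul EB (N.incl p) 0 0
    rw [map_zero]
    simpa using this.symm⟩
  add_mem' := by
    rintro b c ⟨v, hv⟩ ⟨w, hw⟩
    exact ⟨v + w, by rw [map_add, hv, hw, verticalVector_add]⟩
  smul_mem' := by
    rintro r b ⟨v, hv⟩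
    exact ⟨r • v, by rw [map_smul, hv, verticalVector_smul]⟩

/-- The constraint forces `Ψ = S^*((T^E P)°)`. -/
def constraintForces (p : P) : Submodule ℝ (Module.Dual ℝ (A.TEE (N.incl p))) :=
  (N.TE A p).dualAnnihilator.map (A.S (N.incl p)).dualMap

/-- `F = ω_L⁻¹(Ψ)`. -/
def Fspace (p : P) : Submodule ℝ (A.TEE (N.incl p)) :=
  (N.constraintForces A p).comap (A.cartanTwoForm L (N.incl p))

/-- `T^V P = {(b, v) ∈ T^E P | b ∈ V}`, as a subspace of `T^E E`. -/
def TV (p : P) : Submodule ℝ (A.TEE (N.incl p)) :=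
  N.TE A p ⊓ (N.V p).comap (A.proj₂ (N.incl p))

/-- The orthogonal of `T^V P` in `T^E E` with respect to `ω_L`. -/
def TVperp (p : P) : Submodule ℝ (A.TEE (N.incl p)) :=
  (N.TV A p).orthogonalBilin (A.cartanTwoForm L (N.incl p))

/-- The tensor `G^{L,V}`, the restriction of `G^L` to `V`. -/
def GLV (p : P) : N.V p →ₗ[ℝ] N.V p →ₗ[ℝ] ℝ :=
  (A.tensorG L (N.incl p)).domRestrict₁₂ (N.V p) (N.V p)

/-- The Lagrange-d'Alembert equations at a point, for `z ∈ T^E_p P`: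
`i_z ω_L - dE_L ∈ Ψ_p`. -/
def SolvesAt (p : P) (z : N.TEP A p) : Prop :=
  A.cartanTwoForm L (N.incl p) (N.inclusion A p z) - A.d₀ (A.energy L) (N.incl p) ∈
    N.constraintForces A p

/-- Smoothness of a section of `T^E P → P`. -/
def IsSmoothSection (Γ : ∀ p, N.TEP A p) : Prop :=
  ContMDiff 𝓘(ℝ, EP) (𝓘(ℝ, EB).prod 𝓘(ℝ, F)) ∞
    (fun p => (⟨N.pr p, (Γ p).1.1⟩ : TotalSpace F E)) ∧
  ContMDiff 𝓘(ℝ, EP) (𝓘(ℝ, EP).prod 𝓘(ℝ, EP)) ∞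
    (fun p => (⟨p, (Γ p).1.2⟩ : TangentBundle 𝓘(ℝ, EP) P))

/-- The constrained system is regular: the Lagrange-d'Alembert equations have exactly one solution
at every point, and these solutions form a smooth section `Γ` of `T^E P`. -/
def IsRegularSystem : Prop :=
  ∃ Γ : ∀ p, N.TEP A p, N.IsSmoothSection A Γ ∧ ∀ p z, N.SolvesAt A L p z ↔ z = Γ p

end ConstraintSubmanifold
end

noncomputable section

set_option linter.unusedSectionVars false

variable {EB : Type*} [NormedAddCommGroup EB] [NormedSpace ℝ EB]
  {M : Type*} [TopologicalSpace M] [ChartedSpace EB M] [IsManifold 𝓘(ℝ, EB) ∞ M]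
  {F : Type*} [NormedAddCommGroup F] [NormedSpace ℝ F]
  {E : M → Type*} [∀ x, AddCommGroup (E x)] [∀ x, Module ℝ (E x)]
  [∀ x, TopologicalSpace (E x)] [TopologicalSpace (TotalSpace F E)]
  [FiberBundle F E] [VectorBundle ℝ F E] [ContMDiffVectorBundle ∞ F E 𝓘(ℝ, EB)]

/-! All four conditions say that the bilinear form $G^{L,\mathcal V}$ on $\mathcal V$ is
nondegenerate. Since $\mathcal V$ is finite-dimensional, its left and right kernels vanish together,
and symmetry is never needed (`ker_GLV_iff_flip`).

The bridge is that $\omega_L(z,c^V)=G^L(b,c)$ depends only on the projection $b$ of $z$, and that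
regularity of $L$ makes $G^L$ nondegenerate. A vertical lift $b^V$ lies in $\mathcal T^E\mathcal M$
exactly when $b\in\mathcal V$, so $\Psi$ is the annihilator of the elements that project into
$\mathcal V$ (`constraintForces_eq`). All vertical lifts are among these elements; testing on them
shows that $F$ is vertical, and it consists of the $c^V$ with $G^L(\mathcal V,c)=0$
(`mem_Fspace_iff`). Hence $\mathcal T^E\mathcal M\cap F$ is the lifted right kernel of
$G^{L,\mathcal V}$. An element of $\mathcal T^{\mathcal V}\mathcal M\cap(\mathcal T^{\mathcal
V}\mathcal M)^\perp$ projects into the left kernel; once this is zero, the element is vertical and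
comes from the right kernel.

An element of $\mathcal T^E\mathcal M\cap F$ can be added to any solution of the Lagrange–d'Alembert
equations, so uniqueness forces this space to be zero. Conversely, $dE_L(c^V)=G^L(a,c)$
(`d₀_energy_verticalLift`). So for any $z_0\in\mathcal T^E\mathcal M$ over $a$ the defect
$i_{z_0}\omega_L-dE_L$ kills vertical elements, and it is corrected on $\mathcal V$ by a vertical
lift (`exists_solvesAt`).

For smoothness, every solution projects to $a$ (`SolvesAt.fst_eq`), so only its velocity is unknown.
In coordinates the velocity satisfies an overdetermined linear system with smooth coefficients
(`SolvesAt.equationMap_eq`) that is injective at the base point (`equationMap_injective`). A smooth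
left inverse of the system expresses the velocity smoothly. -/

/-! ### Linear algebra: kernels of bilinear forms and annihilators. -/

theorem LinearMap.ker_flip_eq_bot_of_ker_eq_bot {K V : Type*} [Field K] [AddCommGroup V]
    [Module K V] [FiniteDimensional K V] {B : V →ₗ[K] V →ₗ[K] K} (h : LinearMap.ker B = ⊥) :
    LinearMap.ker B.flip = ⊥ := by
  -- An injective map from `V` to its dual is onto by dimension, so a vector killed by all `B b` is
  -- killed by every functional.
  have hs : Function.Surjective B :=
    (LinearMap.injective_iff_surjective_of_finrank_eq_finrank
      (Subspace.dual_finrank_eq (K := K) (V := V)).symm).1 (LinearMap.ker_eq_bot.1 h)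
  refine (LinearMap.ker_eq_bot').2 fun c hc => ?_
  refine (Module.forall_dual_apply_eq_zero_iff K c).1 fun φ => ?_
  obtain ⟨b, rfl⟩ := hs φ
  exact LinearMap.congr_fun hc b

theorem LinearMap.ker_flip_eq_bot_iff_ker_eq_bot {K V : Type*} [Field K] [AddCommGroup V]
    [Module K V] [FiniteDimensional K V] {B : V →ₗ[K] V →ₗ[K] K} :
    LinearMap.ker B.flip = ⊥ ↔ LinearMap.ker B = ⊥ :=
  ⟨fun h => LinearMap.flip_flip B ▸ LinearMap.ker_flip_eq_bot_of_ker_eq_bot h,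
    LinearMap.ker_flip_eq_bot_of_ker_eq_bot⟩

/-- The preimage of `T` is the kernel of `V → W → W ⧸ T`. A functional that vanishes on it factors
through this composite, and over a field the factor extends to all of `W ⧸ T`. -/
theorem Submodule.map_dualMap_dualAnnihilator {K V W : Type*} [Field K] [AddCommGroup V]
    [Module K V] [AddCommGroup W] [Module K W] (T : Submodule K W) (S : V →ₗ[K] W) :
    T.dualAnnihilator.map S.dualMap = (T.comap S).dualAnnihilator := by
  refine le_antisymm ?_ fun η hη => ?_
  · rintro _ ⟨α, hα, rfl⟩
    refine (Submodule.mem_dualAnnihilator _).2 fun z hz => ?_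
    exact (Submodule.mem_dualAnnihilator _).1 hα _ hz
  · have h : LinearMap.ker (T.mkQ ∘ₗ S) = T.comap S := by
      rw [LinearMap.ker_comp, Submodule.ker_mkQ]
    rw [← h, ← LinearMap.range_dualMap_eq_dualAnnihilator_ker] at hη
    obtain ⟨α, rfl⟩ := hη
    refine ⟨α ∘ₗ T.mkQ, (Submodule.mem_dualAnnihilator _).2 fun w hw => ?_, rfl⟩
    simp [(Submodule.Quotient.mk_eq_zero T).2 hw]

/-! ### Vertical vectors as the kernel of the projection. -/

variable (EB F E) in
theorem finiteDimensional_fibre [FiniteDimensional ℝ F] (x : M) : FiniteDimensional ℝ (E x) :=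
  ((trivializationAt F E x).linearEquivAt ℝ x
    (FiberBundle.mem_baseSet_trivializationAt' x)).symm.finiteDimensional

variable (F E) in
theorem finrank_fibre (x : M) : Module.finrank ℝ (E x) = Module.finrank ℝ F :=
  ((trivializationAt F E x).linearEquivAt ℝ x
    (FiberBundle.mem_baseSet_trivializationAt' x)).finrank_eq

/-- The derivative along `b_a^V` is the derivative along the line `t ↦ a + t b`. -/
theorem mfderiv_verticalVector {X : Type*} [NormedAddCommGroup X] [NormedSpace ℝ X]
    {g : TotalSpace F E → X} {a : TotalSpace F E} {b : E a.proj}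
    (hg : MDifferentiableAt (𝓘(ℝ, EB).prod 𝓘(ℝ, F)) 𝓘(ℝ, X) g a) {d : X}
    (hd : HasDerivAt (fun t => g (fibreLine a b t)) d 0) :
    (mfderiv (𝓘(ℝ, EB).prod 𝓘(ℝ, F)) 𝓘(ℝ, X) g a : EB × F →L[ℝ] X)
      (verticalVector EB a b) = d := by
  have hn : (∞ : WithTop ℕ∞) ≠ 0 := by simp
  have h0 : fibreLine a b 0 = a := by simp [fibreLine]
  have h2 := ((contMDiff_fibreLine (EB := EB) a b).mdifferentiable hn 0).hasMFDerivAt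
  have h1 : MDifferentiableAt (𝓘(ℝ, EB).prod 𝓘(ℝ, F)) 𝓘(ℝ, X) g (fibreLine a b 0) := by
    rwa [h0]
  have h3 := congrArg (fun T : ℝ →L[ℝ] X => T 1)
    (hasMFDerivAt_unique (HasMFDerivAt.comp (0 : ℝ) h1.hasMFDerivAt h2) hd.hasFDerivAt.hasMFDerivAt)
  rw [h0] at h3
  exact h3.trans (one_smul ℝ d)

theorem contMDiffAt_trivialization_snd (x : M) {a : TotalSpace F E}
    (ha : a.proj ∈ (trivializationAt F E x).baseSet) :
    ContMDiffAt (𝓘(ℝ, EB).prod 𝓘(ℝ, F)) 𝓘(ℝ, F) ∞ (fun a => (trivializationAt F E x a).2) a := by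
  have h := ((trivializationAt F E x).contMDiffOn (n := ∞) (IB := 𝓘(ℝ, EB))).contMDiffAt
    ((trivializationAt F E x).open_source.mem_nhds ((trivializationAt F E x).mem_source.2 ha))
  exact h.snd

theorem mfderiv_trivialization_verticalVector (x : M) {a : TotalSpace F E}
    (ha : a.proj ∈ (trivializationAt F E x).baseSet) (b : E a.proj) :
    (mfderiv (𝓘(ℝ, EB).prod 𝓘(ℝ, F)) 𝓘(ℝ, F) (fun a => (trivializationAt F E x a).2) a :
      EB × F →L[ℝ] F) (verticalVector EB a b) =
    (trivializationAt F E x).continuousLinearMapAt ℝ a.proj b := by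
  refine mfderiv_verticalVector
    ((contMDiffAt_trivialization_snd x ha).mdifferentiableAt (by simp)) ?_
  have h : (fun t => (trivializationAt F E x (fibreLine a b t)).2) = fun t : ℝ =>
      (trivializationAt F E x).continuousLinearMapAt ℝ a.proj a.2 +
        t • (trivializationAt F E x).continuousLinearMapAt ℝ a.proj b := by
    funext t
    rw [← map_smul, ← map_add]
    simp [fibreLine, Trivialization.coe_linearMapAt_of_mem _ ha]
  rw [h]
  have := ((hasDerivAt_id (0 : ℝ)).smul_const
    ((trivializationAt F E x).continuousLinearMapAt ℝ a.proj b)).const_add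
    ((trivializationAt F E x).continuousLinearMapAt ℝ a.proj a.2)
  simpa using this

theorem verticalVector_injective (a : TotalSpace F E) :
    Function.Injective (verticalVector EB a) := by
  have hx := FiberBundle.mem_baseSet_trivializationAt' (F := F) (E := E) a.proj
  intro b c h
  have h1 := mfderiv_trivialization_verticalVector (EB := EB) a.proj hx b
  rw [h, mfderiv_trivialization_verticalVector a.proj hx c] at h1
  rw [← Trivialization.symmL_continuousLinearMapAt (R := ℝ) _ hx b, ← h1,
    Trivialization.symmL_continuousLinearMapAt _ hx]

variable [FiniteDimensional ℝ EB] [T2Space M]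

-- A global section through `a` is a right inverse of the projection, and so is its differential.
variable (EB) in
theorem mfderiv_proj_surjective (a : TotalSpace F E) :
    Function.Surjective (mfderiv (𝓘(ℝ, EB).prod 𝓘(ℝ, F)) 𝓘(ℝ, EB)
      (TotalSpace.proj : TotalSpace F E → M) a : EB × F →L[ℝ] EB) := by
  intro u
  have hn : (∞ : WithTop ℕ∞) ≠ 0 := by simp
  let σ := extendSection EB F E a.proj a.2
  have h0 : (⟨a.proj, σ a.proj⟩ : TotalSpace F E) = a := by
    rw [show σ a.proj = a.2 from extendSection_apply_self _ _]
  have hp := ((Bundle.contMDiff_proj E (n := ∞) (F := F) (IB := 𝓘(ℝ, EB))).mdifferentiable hn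
    (⟨a.proj, σ a.proj⟩ : TotalSpace F E)).hasMFDerivAt
  have hs := (σ.contMDiff.mdifferentiable hn a.proj).hasMFDerivAt
  have h := hasMFDerivAt_unique (HasMFDerivAt.comp a.proj hp hs) (hasMFDerivAt_id a.proj)
  have h1 := congrArg (fun T : EB →L[ℝ] EB => T u) h
  rw [h0] at h1
  exact ⟨(mfderiv 𝓘(ℝ, EB) (𝓘(ℝ, EB).prod 𝓘(ℝ, F))
    (fun x => (⟨x, σ x⟩ : TotalSpace F E)) a.proj : EB →L[ℝ] EB × F) u, h1⟩

/-- A tangent vector of `E` that projects to zero is a vertical vector. -/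
theorem exists_verticalVector_eq [FiniteDimensional ℝ F] (a : TotalSpace F E)
    {v : TangentSpace (𝓘(ℝ, EB).prod 𝓘(ℝ, F)) a}
    (hv : mfderiv (𝓘(ℝ, EB).prod 𝓘(ℝ, F)) 𝓘(ℝ, EB) (TotalSpace.proj : TotalSpace F E → M) a v = 0) :
    ∃ b, verticalVector EB a b = v := by
  have := finiteDimensional_fibre F E a.proj
  let T : EB × F →ₗ[ℝ] EB := (mfderiv (𝓘(ℝ, EB).prod 𝓘(ℝ, F)) 𝓘(ℝ, EB)
      (TotalSpace.proj : TotalSpace F E → M) a : EB × F →L[ℝ] EB).toLinearMap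
  have hT : Function.Surjective T := mfderiv_proj_surjective EB a
  let j : E a.proj →ₗ[ℝ] EB × F :=
    { toFun := verticalVector EB a
      map_add' := verticalVector_add EB a
      map_smul' := verticalVector_smul EB a }
  have hj : Function.Injective j := verticalVector_injective a
  have hle : LinearMap.range j ≤ LinearMap.ker T := by
    rintro _ ⟨b, rfl⟩
    exact mfderiv_proj_verticalVector a b
  -- The vertical vectors lie in the kernel of the projection, and both spaces have the dimension of
  -- the fibre, so they coincide.
  have hr : Module.finrank ℝ (LinearMap.range j) = Module.finrank ℝ (LinearMap.ker T) := by
    have h1 := LinearMap.finrank_range_of_inj hj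
    have h2 := T.finrank_range_add_finrank_ker
    rw [LinearMap.range_eq_top.2 hT, finrank_top, Module.finrank_prod] at h2
    rw [finrank_fibre F E] at h1
    omega
  have hm : v ∈ LinearMap.ker T := hv
  rw [← Submodule.eq_of_le_of_finrank_eq hle hr] at hm
  exact hm

/-! ### The Cartan form on vertical lifts, and nondegeneracy of $G^L$. -/

namespace LieAlgebroid
variable (A : LieAlgebroid EB F E) (L : C^∞⟮𝓘(ℝ, EB).prod 𝓘(ℝ, F), TotalSpace F E; ℝ⟯)

theorem verticalLift_injective (a : TotalSpace F E) : Function.Injective (A.verticalLift a) :=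
  fun _ _ h => verticalVector_injective (EB := EB) a (congrArg (fun z : A.TEE a => z.1.2) h)

theorem exists_verticalLift_eq [FiniteDimensional ℝ F] (a : TotalSpace F E) {z : A.TEE a}
    (hz : A.proj₂ a z = 0) : ∃ b, A.verticalLift a b = z := by
  have h : A.anchor a.proj z.1.1 = mfderiv (𝓘(ℝ, EB).prod 𝓘(ℝ, F)) 𝓘(ℝ, EB)
    (TotalSpace.proj : TotalSpace F E → M) a z.1.2 := z.2
  rw [show z.1.1 = 0 from hz, map_zero] at h
  obtain ⟨b, hb⟩ := exists_verticalVector_eq a h.symm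
  exact ⟨b, Subtype.ext (Prod.ext hz.symm hb)⟩

theorem cartanTwoForm_swap (a : TotalSpace F E) (z w : A.TEE a) :
    A.cartanTwoForm L a z w = -A.cartanTwoForm L a w z :=
  A.negDTheta_swap L a _ _ _ _

/-- `ω_L(z, c^V)` is the derivative of `θ_L(Z)` along `c_a^V`, where `Z` projects to a section
through the projection of `z`. -/
theorem cartanTwoForm_verticalLift [FiniteDimensional ℝ F] (a : TotalSpace F E) (z : A.TEE a)
    (c : E a.proj) (σ : Cₛ^∞⟮𝓘(ℝ, EB); F, E⟯) (hσ : σ a.proj = A.proj₂ a z) :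
    A.cartanTwoForm L a z (A.verticalLift a c) =
      differential (𝓘(ℝ, EB).prod 𝓘(ℝ, F)) (A.pairing L σ) a (verticalVector EB a c) := by
  have hp : A.pairing L (0 : Cₛ^∞⟮𝓘(ℝ, EB); F, E⟯) a = 0 := by
    have := congrFun (A.pairing_smul L 0 0) a
    simpa using this
  have hd := A.differential_pairing_smul L 0 0 a
  simp only [zero_smul] at hd
  -- A vertical lift projects to zero, so the zero section is an admissible extension; it removes
  -- the bracket term and one of the derivatives.
  rw [A.cartanTwoForm_eq L a z (A.verticalLift a c) σ 0 hσ rfl]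
  simp only [negDTheta, map_zero, hd, LinearMap.zero_apply, hp, zero_sub, sub_zero, neg_neg]
  rfl

/-- If `c` is in the right kernel, then $c^V$ is $\omega_L$-orthogonal to everything, hence zero.
Finite dimension carries this over to the left kernel. -/
theorem ker_tensorG [FiniteDimensional ℝ F] (hL : A.IsRegularLagrangian L) (a : TotalSpace F E) :
    LinearMap.ker (A.tensorG L a) = ⊥ := by
  have := finiteDimensional_fibre F E a.proj
  rw [← LinearMap.ker_flip_eq_bot_iff_ker_eq_bot]
  refine LinearMap.ker_eq_bot'.2 fun c hc => ?_
  refine A.verticalLift_injective a (((hL a).2 _ fun z => ?_).trans (map_zero _).symm)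
  rw [← tensorG_eq]
  exact LinearMap.congr_fun hc _

end LieAlgebroid

/-! ### The pointwise equivalences between the kernel and intersection conditions. -/

namespace ConstraintSubmanifold
variable {EP : Type*} [NormedAddCommGroup EP] [NormedSpace ℝ EP]
  {P : Type*} [TopologicalSpace P] [ChartedSpace EP P] [IsManifold 𝓘(ℝ, EP) ∞ P]
  (N : ConstraintSubmanifold EB F E EP P)
  (A : LieAlgebroid EB F E) (L : C^∞⟮𝓘(ℝ, EB).prod 𝓘(ℝ, F), TotalSpace F E; ℝ⟯)

theorem inclusion_injective (p : P) : Function.Injective (N.inclusion A p) := by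
  intro z w h
  refine Subtype.ext (Prod.ext (congrArg (fun z : A.TEE (N.incl p) => z.1.1) h) ?_)
  exact N.injective_mfderiv_incl p (congrArg (fun z : A.TEE (N.incl p) => z.1.2) h)

theorem verticalLift_mem_TE_iff (p : P) (b : E (N.incl p).proj) :
    A.verticalLift (N.incl p) b ∈ N.TE A p ↔ b ∈ N.V p := by
  constructor
  · rintro ⟨z, hz⟩
    exact ⟨z.1.2, congrArg (fun z : A.TEE (N.incl p) => z.1.2) hz⟩
  · rintro ⟨v, hv⟩
    refine ⟨⟨(0, v), ?_⟩, Subtype.ext (Prod.ext rfl hv)⟩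
    change A.anchor (N.pr p) 0 = mfderiv 𝓘(ℝ, EP) 𝓘(ℝ, EB) N.pr p v
    rw [map_zero, mfderiv_pr, hv]
    exact (mfderiv_proj_verticalVector _ _).symm

/-- This is the submersion condition: a tangent vector of the submanifold can be found over every
anchor. -/
theorem exists_mem_TE_proj₂_eq (p : P) (b : E (N.incl p).proj) :
    ∃ z ∈ N.TE A p, A.proj₂ (N.incl p) z = b := by
  obtain ⟨v, hv⟩ := N.surjective_mfderiv_proj p (A.anchor (N.pr p) b)
  exact ⟨_, ⟨⟨(b, v), hv.symm⟩, rfl⟩, rfl⟩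

/-- The image under $S^*$ of an annihilator is the annihilator of the preimage under $S$, and $S$
sends an element with projection $b$ to $b^V$, which lies in $\mathcal T^E\mathcal M$ exactly when
$b\in\mathcal V$. -/
theorem constraintForces_eq (p : P) : N.constraintForces A p =
    ((N.V p).comap (A.proj₂ (N.incl p))).dualAnnihilator := by
  rw [constraintForces, Submodule.map_dualMap_dualAnnihilator]
  congr 1
  ext z
  exact N.verticalLift_mem_TE_iff A p _

/-- Vertical lifts project to $0\in\mathcal V$, so an element of $F$ is orthogonal to all of them.
Nondegeneracy of $G^L$ then kills its projection. For a vertical $z=c^V$ the remaining conditions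
read $G^L(b,c)=0$ for $b\in\mathcal V$. -/
theorem mem_Fspace_iff [FiniteDimensional ℝ F] (hL : A.IsRegularLagrangian L) (p : P)
    (z : A.TEE (N.incl p)) : z ∈ N.Fspace A L p ↔ ∃ c, A.verticalLift (N.incl p) c = z ∧
      ∀ b ∈ N.V p, A.tensorG L (N.incl p) b c = 0 := by
  rw [Fspace, Submodule.mem_comap, constraintForces_eq, Submodule.mem_dualAnnihilator]
  constructor
  · intro h
    have hz : A.proj₂ (N.incl p) z = 0 := by
      refine LinearMap.ker_eq_bot'.1 (A.ker_tensorG L hL (N.incl p)) _ ?_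
      ext c
      rw [LieAlgebroid.tensorG_eq]
      exact h _ (show A.proj₂ (N.incl p) (A.verticalLift (N.incl p) c) ∈ N.V p from
        Submodule.zero_mem _)
    obtain ⟨c, rfl⟩ := A.exists_verticalLift_eq _ hz
    refine ⟨c, rfl, fun b hb => ?_⟩
    obtain ⟨w, rfl⟩ := A.proj₂_surjective (N.incl p) b
    rw [LieAlgebroid.tensorG_eq, LieAlgebroid.cartanTwoForm_swap, h w hb, neg_zero]
  · rintro ⟨c, rfl, h⟩ w hw
    rw [LieAlgebroid.cartanTwoForm_swap, ← LieAlgebroid.tensorG_eq, h _ hw, neg_zero]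

/-- The intersections detect the right kernel of the form, while the definition of `ker` gives the
left one. -/
theorem ker_GLV_iff_flip [FiniteDimensional ℝ F] (p : P) : LinearMap.ker (N.GLV A L p) = ⊥ ↔
    ∀ c ∈ N.V p, (∀ b ∈ N.V p, A.tensorG L (N.incl p) b c = 0) → c = 0 := by
  have := finiteDimensional_fibre F E (N.incl p).proj
  rw [← LinearMap.ker_flip_eq_bot_iff_ker_eq_bot, LinearMap.ker_eq_bot']
  constructor
  · intro h c hc h1
    have := h ⟨c, hc⟩ (by ext b; exact h1 b b.2)
    exact congrArg Subtype.val this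
  · intro h c hc
    exact Subtype.ext (h c c.2 fun b hb => LinearMap.congr_fun hc ⟨b, hb⟩)

theorem ker_GLV_iff_TE_inf_Fspace [FiniteDimensional ℝ F] (hL : A.IsRegularLagrangian L) (p : P) :
    LinearMap.ker (N.GLV A L p) = ⊥ ↔ N.TE A p ⊓ N.Fspace A L p = ⊥ := by
  rw [ker_GLV_iff_flip, Submodule.eq_bot_iff]
  constructor
  · rintro h z ⟨hz, hF⟩
    obtain ⟨c, rfl, hc⟩ := (N.mem_Fspace_iff A L hL p z).1 hF
    rw [h c ((N.verticalLift_mem_TE_iff A p c).1 hz) hc, map_zero]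
  · intro h c hc h1
    have := h _ ⟨(N.verticalLift_mem_TE_iff A p c).2 hc,
      (N.mem_Fspace_iff A L hL p _).2 ⟨c, rfl, h1⟩⟩
    exact A.verticalLift_injective _ (this.trans (map_zero _).symm)

theorem verticalLift_mem_TV (p : P) {c : E (N.incl p).proj} (hc : c ∈ N.V p) :
    A.verticalLift (N.incl p) c ∈ N.TV A p :=
  ⟨(N.verticalLift_mem_TE_iff A p c).2 hc, Submodule.zero_mem (N.V p)⟩

/-- Both kernels are used: orthogonality to lifts of $\mathcal V$ puts the projection in the left
kernel, so the element is some $c^V$; orthogonality to the rest then puts $c$ in the right kernel.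
-/
theorem ker_GLV_iff_TV_inf_TVperp [FiniteDimensional ℝ F] (p : P) :
    LinearMap.ker (N.GLV A L p) = ⊥ ↔ N.TV A p ⊓ N.TVperp A L p = ⊥ := by
  constructor
  · intro h
    have h' := (N.ker_GLV_iff_flip A L p).1 h
    refine (Submodule.eq_bot_iff _).2 ?_
    rintro z ⟨⟨hz, hzV⟩, hp⟩
    have hp' := Submodule.mem_orthogonalBilin_iff.1 hp
    have h0 : A.proj₂ (N.incl p) z = 0 := by
      have h1 := LinearMap.ker_eq_bot'.1 h ⟨A.proj₂ (N.incl p) z, hzV⟩ (by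
        ext c
        change A.tensorG L (N.incl p) (A.proj₂ (N.incl p) z) c = 0
        rw [LieAlgebroid.tensorG_eq, LieAlgebroid.cartanTwoForm_swap,
          show A.cartanTwoForm L (N.incl p) _ z = 0 from hp' _ (N.verticalLift_mem_TV A p c.2),
          neg_zero])
      exact congrArg Subtype.val h1
    obtain ⟨c, rfl⟩ := A.exists_verticalLift_eq _ h0
    rw [h' c ((N.verticalLift_mem_TE_iff A p c).1 hz), map_zero]
    intro b hb
    -- Orthogonality is known only against $\mathcal T^{\mathcal V}\mathcal M$, so `b` has to be
    -- lifted inside $\mathcal T^E\mathcal M$.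
    obtain ⟨w, hw, rfl⟩ := N.exists_mem_TE_proj₂_eq A p b
    rw [LieAlgebroid.tensorG_eq]
    exact hp' w ⟨hw, hb⟩
  · intro h
    refine (N.ker_GLV_iff_flip A L p).2 fun c hc h1 => ?_
    have := (Submodule.eq_bot_iff _).1 h (A.verticalLift (N.incl p) c)
      ⟨N.verticalLift_mem_TV A p hc, Submodule.mem_orthogonalBilin_iff.2 fun w hw => by
        change A.cartanTwoForm L (N.incl p) w _ = 0
        rw [← LieAlgebroid.tensorG_eq]
        exact h1 _ hw.2⟩
    exact A.verticalLift_injective _ (this.trans (map_zero _).symm)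

theorem solvesAt_iff (p : P) (z : N.TEP A p) : N.SolvesAt A L p z ↔
    ∀ w : A.TEE (N.incl p), A.proj₂ (N.incl p) w ∈ N.V p →
      A.cartanTwoForm L (N.incl p) (N.inclusion A p z) w = A.d₀ (A.energy L) (N.incl p) w := by
  rw [SolvesAt, constraintForces_eq, Submodule.mem_dualAnnihilator]
  exact forall₂_congr fun w _ => by rw [LinearMap.sub_apply, sub_eq_zero]

/-- If solutions are unique then `T^E P ∩ F = 0`. -/
theorem IsRegularSystem.TE_inf_Fspace (h : N.IsRegularSystem A L) (p : P) :
    N.TE A p ⊓ N.Fspace A L p = ⊥ := by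
  obtain ⟨Γ, -, h⟩ := h
  refine (Submodule.eq_bot_iff _).2 ?_
  rintro _ ⟨⟨z, rfl⟩, hF⟩
  -- The equations are affine, and the solutions of the homogeneous equations are the elements of
  -- $\mathcal T^E\mathcal M\cap F$.
  have h1 : N.SolvesAt A L p (Γ p + z) := by
    have h2 : N.SolvesAt A L p (Γ p) := (h p _).2 rfl
    unfold SolvesAt at h2 ⊢
    rw [map_add, map_add, add_sub_right_comm]
    exact Submodule.add_mem _ h2 hF
  rw [add_eq_left.1 ((h p _).1 h1), map_zero]

end ConstraintSubmanifold

/-- A frame section has constant coordinates where the bump function is `1`. -/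
theorem frameSection_continuousLinearMapAt {x₀ x : M}
    (hx : x ∈ (trivializationAt F E x₀).baseSet) (hb : bump EB F E x₀ x = 1) (b : E x) :
    frameSection EB F E x₀ ((trivializationAt F E x₀).continuousLinearMapAt ℝ x b) x = b := by
  change bump EB F E x₀ x • (trivializationAt F E x₀).symmL ℝ x
    ((trivializationAt F E x₀).continuousLinearMapAt ℝ x b) = b
  rw [hb, one_smul, Trivialization.symmL_continuousLinearMapAt _ hx]

/-! ### The energy and the Cartan one-form in local frames. -/

namespace LieAlgebroid
variable (A : LieAlgebroid EB F E) (L : C^∞⟮𝓘(ℝ, EB).prod 𝓘(ℝ, F), TotalSpace F E; ℝ⟯)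

theorem energy_eq_pairing (a : TotalSpace F E) {σ : Cₛ^∞⟮𝓘(ℝ, EB); F, E⟯} (hσ : σ a.proj = a.2) :
    A.energy L a = A.pairing L σ a - L a := by
  simp only [energy, pairing, liouville, hσ]

/-- The value of `θ_L` on the sections which project to a frame section, as a function of the
coordinates of the frame section. -/
def framePairing [FiniteDimensional ℝ F] (x₀ : M) (a : TotalSpace F E) : F →L[ℝ] ℝ :=
  LinearMap.toContinuousLinearMap
    { toFun := fun w => A.pairing L (frameSection EB F E x₀ w) a
      map_add' := fun w w' => by rw [map_add, pairing_add, Pi.add_apply]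
      map_smul' := fun r w => by rw [map_smul, pairing_smul]; rfl }

end LieAlgebroid

/-! ### Smooth families of linear maps and their one-sided inverses. -/

/-- A family of linear maps on a finite-dimensional space is smooth if its values on every vector
are. -/
theorem contMDiffAt_clm_of_apply {EN : Type*} [NormedAddCommGroup EN] [NormedSpace ℝ EN]
    {HN : Type*} [TopologicalSpace HN] {IN : ModelWithCorners ℝ EN HN} {Q : Type*}
    [TopologicalSpace Q] [ChartedSpace HN Q] {V X : Type*} [NormedAddCommGroup V] [NormedSpace ℝ V]
    [FiniteDimensional ℝ V] [NormedAddCommGroup X] [NormedSpace ℝ X] {φ : Q → V →L[ℝ] X} {q : Q}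
    (h : ∀ w, ContMDiffAt IN 𝓘(ℝ, X) ∞ (fun q => φ q w) q) :
    ContMDiffAt IN 𝓘(ℝ, V →L[ℝ] X) ∞ φ q := by
  let β := Module.finBasis ℝ V
  have h1 : φ = fun q => ∑ i, ContinuousLinearMap.smulRightL ℝ V X
      (LinearMap.toContinuousLinearMap (β.coord i)) (φ q (β i)) := by
    funext q
    refine ContinuousLinearMap.coe_injective (β.ext fun j => ?_)
    simp [Finsupp.single_apply]
  rw [h1]
  refine ContMDiffAt.sum fun i _ => ?_
  exact (ContinuousLinearMap.contMDiff _).contMDiffAt.comp q (h (β i))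

/-- A smooth family of linear maps which is injective at a point has a smooth family of left
inverses near this point. -/
theorem exists_smooth_leftInverse {EN : Type*} [NormedAddCommGroup EN] [NormedSpace ℝ EN]
    {HN : Type*} [TopologicalSpace HN] {IN : ModelWithCorners ℝ EN HN} {Q : Type*}
    [TopologicalSpace Q] [ChartedSpace HN Q] {V X : Type*} [NormedAddCommGroup V] [NormedSpace ℝ V]
    [FiniteDimensional ℝ V] [NormedAddCommGroup X] [NormedSpace ℝ X] [FiniteDimensional ℝ X]
    {Φ : Q → V →L[ℝ] X} {q₀ : Q} (hΦ : ContMDiffAt IN 𝓘(ℝ, V →L[ℝ] X) ∞ Φ q₀)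
    (hinj : Function.Injective (Φ q₀)) :
    ∃ Λ : Q → X →L[ℝ] V, ContMDiffAt IN 𝓘(ℝ, X →L[ℝ] V) ∞ Λ q₀ ∧
      ∀ᶠ q in 𝓝 q₀, Λ q ∘L Φ q = ContinuousLinearMap.id ℝ V := by
  have := FiniteDimensional.complete ℝ V
  obtain ⟨l, hl⟩ := (Φ q₀ : V →ₗ[ℝ] X).exists_leftInverse_of_injective (LinearMap.ker_eq_bot.2 hinj)
  -- With `l'` a left inverse at `q₀`, the endomorphism `l' ∘L Φ q` is the identity at `q₀`, hence
  -- invertible nearby with smooth inverse; the left inverse is `(l' ∘L Φ q)⁻¹ ∘L l'`.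
  let l' : X →L[ℝ] V := LinearMap.toContinuousLinearMap l
  have hΨ : ContMDiffAt IN 𝓘(ℝ, V →L[ℝ] V) ∞ (fun q => l' ∘L Φ q) q₀ :=
    contMDiffAt_const.clm_comp hΦ
  have h0 : l' ∘L Φ q₀ = ((ContinuousLinearEquiv.refl ℝ V : V ≃L[ℝ] V) : V →L[ℝ] V) := by
    ext v
    exact LinearMap.congr_fun hl v
  have hinv : ContMDiffAt IN 𝓘(ℝ, V →L[ℝ] V) ∞
      (fun q => ContinuousLinearMap.inverse (l' ∘L Φ q)) q₀ := by
    have h1 := contDiffAt_map_inverse (n := ∞) (ContinuousLinearEquiv.refl ℝ V)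
    rw [← h0] at h1
    exact h1.contMDiffAt.comp q₀ hΨ
  refine ⟨fun q => ContinuousLinearMap.inverse (l' ∘L Φ q) ∘L l',
    hinv.clm_comp contMDiffAt_const, ?_⟩
  have hU : {T : V →L[ℝ] V | ∃ e : V ≃L[ℝ] V, (e : V →L[ℝ] V) = T} ∈ 𝓝 (l' ∘L Φ q₀) := by
    rw [h0]
    exact ContinuousLinearEquiv.nhds _
  filter_upwards [hΨ.continuousAt.preimage_mem_nhds hU] with q hq
  obtain ⟨e, he⟩ : ∃ e : V ≃L[ℝ] V, (e : V →L[ℝ] V) = l' ∘L Φ q := hq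
  rw [ContinuousLinearMap.comp_assoc, ← he, ContinuousLinearMap.inverse_equiv]
  exact e.coe_symm_comp_coe

/-- A smooth family of linear maps which is surjective at a point has a smooth family of right
inverses near this point. -/
theorem exists_smooth_rightInverse {EN : Type*} [NormedAddCommGroup EN] [NormedSpace ℝ EN]
    {HN : Type*} [TopologicalSpace HN] {IN : ModelWithCorners ℝ EN HN} {Q : Type*}
    [TopologicalSpace Q] [ChartedSpace HN Q] {V X : Type*} [NormedAddCommGroup V] [NormedSpace ℝ V]
    [FiniteDimensional ℝ V] [NormedAddCommGroup X] [NormedSpace ℝ X] [FiniteDimensional ℝ X]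
    {Φ : Q → V →L[ℝ] X} {q₀ : Q} (hΦ : ContMDiffAt IN 𝓘(ℝ, V →L[ℝ] X) ∞ Φ q₀)
    (hsurj : Function.Surjective (Φ q₀)) :
    ∃ J : Q → X →L[ℝ] V, ContMDiffAt IN 𝓘(ℝ, X →L[ℝ] V) ∞ J q₀ ∧
      ∀ᶠ q in 𝓝 q₀, Φ q ∘L J q = ContinuousLinearMap.id ℝ X := by
  obtain ⟨r, hr⟩ := (Φ q₀ : V →ₗ[ℝ] X).exists_rightInverse_of_surjective
    (LinearMap.range_eq_top.2 hsurj)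
  let r' : X →L[ℝ] V := LinearMap.toContinuousLinearMap r
  have hr' : ∀ x, Φ q₀ (r' x) = x := LinearMap.congr_fun hr
  have hΨ : ContMDiffAt IN 𝓘(ℝ, X →L[ℝ] X) ∞ (fun q => Φ q ∘L r') q₀ :=
    hΦ.clm_comp contMDiffAt_const
  obtain ⟨Λ, hΛ, h⟩ := exists_smooth_leftInverse hΨ fun x y hxy => by
    simpa only [ContinuousLinearMap.comp_apply, hr'] using hxy
  refine ⟨fun q => r' ∘L Λ q, contMDiffAt_const.clm_comp hΛ, ?_⟩
  filter_upwards [h] with q hq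
  have h1 : (Λ q : X →ₗ[ℝ] X) * ((Φ q ∘L r' : X →L[ℝ] X) : X →ₗ[ℝ] X) = 1 := by
    ext x
    exact DFunLike.congr_fun hq x
  -- On a finite-dimensional space a one-sided inverse of an endomorphism is two-sided.
  have h2 := mul_eq_one_comm.1 h1
  ext x
  exact LinearMap.congr_fun h2 x

/-! ### Derivatives on a manifold as maps on a fixed model space. -/

section CoordinateDerivative

variable {EP : Type*} [NormedAddCommGroup EP] [NormedSpace ℝ EP]
  {P : Type*} [TopologicalSpace P] [ChartedSpace EP P] [IsManifold 𝓘(ℝ, EP) ∞ P]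
  {X : Type*} [NormedAddCommGroup X] [NormedSpace ℝ X]

/-- The derivative at `p` of a function on a manifold, in the coordinates at `p₀`. -/
def coordDeriv (p₀ : P) (g : P → X) (p : P) : EP →L[ℝ] X :=
  (mfderiv 𝓘(ℝ, EP) 𝓘(ℝ, X) g p : EP →L[ℝ] X) ∘L
    ((trivializationAt EP (TangentSpace 𝓘(ℝ, EP) : P → Type _) p₀).symmL ℝ p : EP →L[ℝ] EP)

theorem coordDeriv_continuousLinearMapAt {p₀ p : P} (hp : p ∈ (chartAt EP p₀).source) (g : P → X)
    (v : TangentSpace 𝓘(ℝ, EP) p) : coordDeriv (EP := EP) p₀ g p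
      ((trivializationAt EP (TangentSpace 𝓘(ℝ, EP) : P → Type _) p₀).continuousLinearMapAt ℝ p v) =
      mfderiv 𝓘(ℝ, EP) 𝓘(ℝ, X) g p v := by
  have h := (trivializationAt EP (TangentSpace 𝓘(ℝ, EP) : P → Type _) p₀).symmL_continuousLinearMapAt
    (R := ℝ) (by simpa using hp : p ∈ _) v
  exact congrArg (mfderiv 𝓘(ℝ, EP) 𝓘(ℝ, X) g p : EP →L[ℝ] X) h

theorem contMDiffAt_coordDeriv {p₀ : P} {g : P → X} (hg : ContMDiffAt 𝓘(ℝ, EP) 𝓘(ℝ, X) ∞ g p₀) :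
    ContMDiffAt 𝓘(ℝ, EP) 𝓘(ℝ, EP →L[ℝ] X) ∞ (coordDeriv (EP := EP) p₀ g) p₀ := by
  have h := hg.mfderiv_const (m := ∞) (by simp)
  refine h.congr_of_eventuallyEq (Filter.Eventually.of_forall fun p => ?_)
  simp only [inTangentCoordinates, ContinuousLinearMap.inCoordinates]
  rw [TangentBundle.continuousLinearMapAt_model_space]
  rfl

end CoordinateDerivative

/-! ### Smoothness of the energy and its vertical derivative. -/

namespace LieAlgebroid
variable (A : LieAlgebroid EB F E) (L : C^∞⟮𝓘(ℝ, EB).prod 𝓘(ℝ, F), TotalSpace F E; ℝ⟯)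

theorem contMDiff_framePairing [FiniteDimensional ℝ F] (x₀ : M) :
    ContMDiff (𝓘(ℝ, EB).prod 𝓘(ℝ, F)) 𝓘(ℝ, F →L[ℝ] ℝ) ∞ (A.framePairing L x₀) := fun _ =>
  contMDiffAt_clm_of_apply fun _ => A.contMDiff_pairing L.contMDiff _ _

variable (EB F E) in
theorem eventually_mem_baseSet_and_bump_eq_one (x₀ : M) : ∀ᶠ x in 𝓝 x₀,
    x ∈ (trivializationAt F E x₀).baseSet ∧ bump EB F E x₀ x = 1 :=
  ((trivializationAt F E x₀).open_baseSet.eventually_mem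
    (FiberBundle.mem_baseSet_trivializationAt' x₀)).and (bump EB F E x₀).eventuallyEq_one

theorem contMDiff_energy [FiniteDimensional ℝ F] :
    ContMDiff (𝓘(ℝ, EB).prod 𝓘(ℝ, F)) 𝓘(ℝ, ℝ) ∞ (A.energy L) := by
  intro a₀
  have hp := (Bundle.contMDiff_proj E (n := ∞) (F := F) (IB := 𝓘(ℝ, EB))) a₀
  -- Near `a₀` the energy is the frame pairing evaluated on the fibre coordinates of the point
  -- itself, minus `L`.
  have h := ((A.contMDiff_framePairing L a₀.proj a₀).clm_apply
    (contMDiffAt_trivialization_snd a₀.proj (FiberBundle.mem_baseSet_trivializationAt' _))).sub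
    (L.contMDiff a₀)
  refine h.congr_of_eventuallyEq ?_
  filter_upwards [hp.continuousAt.eventually
    (eventually_mem_baseSet_and_bump_eq_one EB F E a₀.proj)] with a ha
  rw [A.energy_eq_pairing L a (frameSection_continuousLinearMapAt ha.1 ha.2 a.2)]
  change A.pairing L _ a - L a = A.pairing L _ a - L a
  simp [Trivialization.coe_linearMapAt_of_mem _ ha.1]

/-- `i_{b^V} dE_L = G^L(a, b)` at `a`. -/
theorem d₀_energy_verticalLift [FiniteDimensional ℝ F] (a : TotalSpace F E) (c : E a.proj) :
    A.d₀ (A.energy L) a (A.verticalLift a c) = A.tensorG L a a.2 c := by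
  have hn : (∞ : WithTop ℕ∞) ≠ 0 := by simp
  let σ := extendSection EB F E a.proj
  have hσ : ∀ b : E a.proj, σ b a.proj = b := extendSection_apply_self _
  have hder : ∀ g : TotalSpace F E → ℝ, MDifferentiableAt (𝓘(ℝ, EB).prod 𝓘(ℝ, F)) 𝓘(ℝ, ℝ) g a →
      HasDerivAt (fun t => g (fibreLine a c t))
        (differential (𝓘(ℝ, EB).prod 𝓘(ℝ, F)) g a (verticalVector EB a c)) 0 := by
    intro g hg
    have h0 : fibreLine a c 0 = a := by simp [fibreLine]
    have h2 := (contMDiff_fibreLine (EB := EB) a c).mdifferentiable hn 0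
    have hg' : MDifferentiableAt (𝓘(ℝ, EB).prod 𝓘(ℝ, F)) 𝓘(ℝ, ℝ) g (fibreLine a c 0) := by rwa [h0]
    have h3 : DifferentiableAt ℝ (fun t => g (fibreLine a c t)) 0 :=
      mdifferentiableAt_iff_differentiableAt.1 (hg'.comp (0 : ℝ) h2)
    have h4 : differential (𝓘(ℝ, EB).prod 𝓘(ℝ, F)) g a (verticalVector EB a c) =
      deriv (fun t => g (fibreLine a c t)) 0 := mfderiv_verticalVector hg h3.hasDerivAt
    rw [h4]
    exact h3.hasDerivAt
  obtain ⟨z, hz⟩ := A.proj₂_surjective a a.2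
  have hG : A.tensorG L a a.2 c =
      differential (𝓘(ℝ, EB).prod 𝓘(ℝ, F)) (A.pairing L (σ a.2)) a (verticalVector EB a c) := by
    have h := A.tensorG_eq L a z c
    rw [hz] at h
    rw [h, A.cartanTwoForm_verticalLift L a z c (σ a.2) ((hσ _).trans hz.symm)]
  -- By linearity of the extension, $\sigma(a)+t\,\sigma(c)$ is a section through $a+tc$.
  have hE : (fun t => A.energy L (fibreLine a c t)) = fun t =>
      A.pairing L (σ a.2) (fibreLine a c t) + t * A.pairing L (σ c) (fibreLine a c t)
        - L (fibreLine a c t) := by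
    funext t
    rw [A.energy_eq_pairing L (fibreLine a c t) (σ := σ (a.2 + t • c)) (hσ (a.2 + t • c)),
      map_add, map_smul, pairing_add, pairing_smul]
    rfl
  have h1 := hder _ (A.mdifferentiableAt_pairing L (σ a.2) a)
  have h2 := hder _ (A.mdifferentiableAt_pairing L (σ c) a)
  have h3 := hder _ (L.contMDiff.mdifferentiable hn a)
  have h4 := hder _ ((A.contMDiff_energy L).mdifferentiable hn a)
  rw [hE] at h4
  have h5 := h4.unique ((h1.add ((hasDerivAt_id (0 : ℝ)).mul h2)).sub h3)
  rw [hG]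
  refine Eq.trans h5 ?_
  -- The product rule leaves $\theta_L$ on $\sigma(c)$ at $a$, which is the derivative of `L` along
  -- $c^V$ and cancels the term from $-L$.
  have h6 : A.pairing L (σ c) (fibreLine a c 0) =
      differential (𝓘(ℝ, EB).prod 𝓘(ℝ, F)) L a (verticalVector EB a c) := by
    have h0 : fibreLine a c 0 = a := by simp [fibreLine]
    rw [h0, pairing, hσ]
    rfl
  rw [h6]
  simp

end LieAlgebroid

/-! ### Existence and uniqueness of solutions at a point. -/

namespace ConstraintSubmanifold
variable {EP : Type*} [NormedAddCommGroup EP] [NormedSpace ℝ EP]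
  {P : Type*} [TopologicalSpace P] [ChartedSpace EP P] [IsManifold 𝓘(ℝ, EP) ∞ P]
  (N : ConstraintSubmanifold EB F E EP P)
  (A : LieAlgebroid EB F E) (L : C^∞⟮𝓘(ℝ, EB).prod 𝓘(ℝ, F), TotalSpace F E; ℝ⟯)

variable {N A L} in
/-- Solutions of the Lagrange-d'Alembert equations are second order. -/
theorem SolvesAt.fst_eq [FiniteDimensional ℝ F] (hL : A.IsRegularLagrangian L) {p : P}
    {z : N.TEP A p} (h : N.SolvesAt A L p z) : z.1.1 = (N.incl p).2 := by
  rw [solvesAt_iff] at h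
  -- Testing the equation on $c^V$ gives $G^L(b,c)=G^L(a,c)$ for all $c$, where $b$ is the
  -- projection of the solution.
  have h0 : A.proj₂ (N.incl p) (N.inclusion A p z) - (N.incl p).2 = 0 := by
    refine LinearMap.ker_eq_bot'.1 (A.ker_tensorG L hL (N.incl p)) _ ?_
    ext c
    rw [map_sub, LinearMap.sub_apply, ← LieAlgebroid.d₀_energy_verticalLift,
      ← h _ (show A.proj₂ (N.incl p) (A.verticalLift (N.incl p) c) ∈ N.V p from
        Submodule.zero_mem _), ← LieAlgebroid.tensorG_eq]
    exact sub_self _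
  exact sub_eq_zero.1 h0

/-- The defect of any $z_0\in\mathcal T^E\mathcal M$ over $a$ kills vertical elements, so it defines
a functional on $\mathcal V$. This functional is $G^{L,\mathcal V}(\cdot,u)$ for some $u$, and
adding $u^V\in\mathcal T^E\mathcal M$ cancels it, because $\omega_L(u^V,w)=-G^L(b,u)$ for $w$ over
$b$. -/
theorem exists_solvesAt [FiniteDimensional ℝ F] (p : P) (hG : LinearMap.ker (N.GLV A L p) = ⊥) :
    ∃ z, N.SolvesAt A L p z := by
  have := finiteDimensional_fibre F E (N.incl p).proj
  obtain ⟨v, hv⟩ := N.surjective_mfderiv_proj p (A.anchor (N.pr p) (N.incl p).2)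
  let z₀ : N.TEP A p := ⟨((N.incl p).2, v), hv.symm⟩
  let η := A.cartanTwoForm L (N.incl p) (N.inclusion A p z₀) - A.d₀ (A.energy L) (N.incl p)
  have hη : ∀ z, A.proj₂ (N.incl p) z = 0 → η z = 0 := by
    intro z hz
    obtain ⟨c, rfl⟩ := A.exists_verticalLift_eq _ hz
    change A.cartanTwoForm L (N.incl p) (N.inclusion A p z₀) _ - A.d₀ _ _ _ = 0
    rw [LieAlgebroid.d₀_energy_verticalLift, ← LieAlgebroid.tensorG_eq]
    exact sub_self _
  have hs : Function.Surjective (N.GLV A L p).flip :=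
    (LinearMap.injective_iff_surjective_of_finrank_eq_finrank
      (Subspace.dual_finrank_eq (K := ℝ) (V := N.V p)).symm).1
      (LinearMap.ker_eq_bot.1 (LinearMap.ker_flip_eq_bot_of_ker_eq_bot hG))
  obtain ⟨u, hu⟩ := hs (η ∘ₗ A.lift (N.incl p) ∘ₗ (N.V p).subtype)
  obtain ⟨zu, hzu⟩ := (N.verticalLift_mem_TE_iff A p u).2 u.2
  refine ⟨z₀ + zu, (N.solvesAt_iff A L p _).2 fun w hw => ?_⟩
  have h1 : A.tensorG L (N.incl p) (A.proj₂ (N.incl p) w) u =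
      η (A.lift (N.incl p) (A.proj₂ (N.incl p) w)) := LinearMap.congr_fun hu ⟨_, hw⟩
  have h2 := hη (w - A.lift (N.incl p) (A.proj₂ (N.incl p) w))
    (by rw [map_sub, LieAlgebroid.proj₂_lift, sub_self])
  rw [map_sub, ← h1, LieAlgebroid.tensorG_eq, LieAlgebroid.cartanTwoForm_swap] at h2
  have h3 : η w = A.cartanTwoForm L (N.incl p) (N.inclusion A p z₀) w
    - A.d₀ (A.energy L) (N.incl p) w := rfl
  rw [map_add, hzu, map_add, LinearMap.add_apply]
  linarith

variable {N A L} in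
theorem SolvesAt.unique {p : P} (h : N.TE A p ⊓ N.Fspace A L p = ⊥) {z z' : N.TEP A p}
    (hz : N.SolvesAt A L p z) (hz' : N.SolvesAt A L p z') : z = z' := by
  have h1 : N.inclusion A p (z - z') ∈ N.Fspace A L p := by
    have h2 := Submodule.sub_mem _ hz hz'
    rw [sub_sub_sub_cancel_right, ← map_sub, ← map_sub] at h2
    exact h2
  refine sub_eq_zero.1 (N.inclusion_injective A p ?_)
  rw [map_zero]
  exact (Submodule.eq_bot_iff _).1 h _ ⟨⟨_, rfl⟩, h1⟩

/-- The Lagrange-d'Alembert equations on the elements `(c, w)` of `T^V P`, as equations on `P`. -/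
theorem SolvesAt.apply_TV [FiniteDimensional ℝ F] {p : P} {z : N.TEP A p}
    (h : N.SolvesAt A L p z) (y : N.TEP A p) (hy : y.1.1 ∈ N.V p)
    (σ₁ σ₂ : Cₛ^∞⟮𝓘(ℝ, EB); F, E⟯) (h₁ : σ₁ (N.pr p) = z.1.1) (h₂ : σ₂ (N.pr p) = y.1.1) :
    differential 𝓘(ℝ, EP) (fun p => A.pairing L σ₂ (N.incl p)) p z.1.2 =
      differential 𝓘(ℝ, EP) (fun p => A.pairing L σ₁ (N.incl p)) p y.1.2
      + A.pairing L (A.bracket σ₁ σ₂) (N.incl p)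
      - differential 𝓘(ℝ, EP) (fun p => A.energy L (N.incl p)) p y.1.2 := by
  have hn : (∞ : WithTop ℕ∞) ≠ 0 := by simp
  have hi := (N.contMDiff_incl.mdifferentiable hn p).hasMFDerivAt
  -- The anchors of both elements are tangent to the submanifold, so only restrictions of functions
  -- to `P` are differentiated.
  have hc : ∀ g : TotalSpace F E → ℝ, ContMDiff (𝓘(ℝ, EB).prod 𝓘(ℝ, F)) 𝓘(ℝ, ℝ) ∞ g →
      ∀ v : TangentSpace 𝓘(ℝ, EP) p, differential 𝓘(ℝ, EP) (fun p => g (N.incl p)) p v =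
        differential (𝓘(ℝ, EB).prod 𝓘(ℝ, F)) g (N.incl p)
          (mfderiv 𝓘(ℝ, EP) (𝓘(ℝ, EB).prod 𝓘(ℝ, F)) N.incl p v) := fun g hg v =>
    congrArg (fun T : EP →L[ℝ] ℝ => T v)
      (HasMFDerivAt.comp p (hg.mdifferentiable hn (N.incl p)).hasMFDerivAt hi).mfderiv
  have h3 := (N.solvesAt_iff A L p z).1 h (N.inclusion A p y) hy
  rw [A.cartanTwoForm_eq L (N.incl p) (N.inclusion A p z) (N.inclusion A p y) σ₁ σ₂ h₁ h₂] at h3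
  rw [hc _ (A.contMDiff_pairing L.contMDiff σ₁), hc _ (A.contMDiff_pairing L.contMDiff σ₂),
    hc _ (A.contMDiff_energy L)]
  have h4 : -(differential (𝓘(ℝ, EB).prod 𝓘(ℝ, F)) (A.pairing L σ₂) (N.incl p)
        (mfderiv 𝓘(ℝ, EP) (𝓘(ℝ, EB).prod 𝓘(ℝ, F)) N.incl p z.1.2)
      - differential (𝓘(ℝ, EB).prod 𝓘(ℝ, F)) (A.pairing L σ₁) (N.incl p)
        (mfderiv 𝓘(ℝ, EP) (𝓘(ℝ, EB).prod 𝓘(ℝ, F)) N.incl p y.1.2)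
      - A.pairing L (A.bracket σ₁ σ₂) (N.incl p)) =
      differential (𝓘(ℝ, EB).prod 𝓘(ℝ, F)) (A.energy L) (N.incl p)
        (mfderiv 𝓘(ℝ, EP) (𝓘(ℝ, EB).prod 𝓘(ℝ, F)) N.incl p y.1.2) := h3
  linarith

end ConstraintSubmanifold

/-! ### Anchor and bracket in local frames. -/

namespace LieAlgebroid
variable (A : LieAlgebroid EB F E) (L : C^∞⟮𝓘(ℝ, EB).prod 𝓘(ℝ, F), TotalSpace F E; ℝ⟯)

/-- The anchor in the trivializations of `E` and `TM` at `x₀`. -/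
def anchorCoord [FiniteDimensional ℝ F] (x₀ x : M) : F →L[ℝ] EB :=
  LinearMap.toContinuousLinearMap
    { toFun := fun w => ((trivializationAt EB (TangentSpace 𝓘(ℝ, EB) : M → Type _)
        x₀).continuousLinearMapAt ℝ x (A.anchor x (frameSection EB F E x₀ w x)) : EB)
      map_add' := fun w w' => by
        rw [map_add, ContMDiffSection.coe_add, Pi.add_apply, map_add, map_add]
      map_smul' := fun r w => by
        rw [map_smul, ContMDiffSection.coe_smul, Pi.smul_apply, map_smul, map_smul]; rfl }

theorem contMDiffAt_anchorCoord [FiniteDimensional ℝ F] (x₀ : M) :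
    ContMDiffAt 𝓘(ℝ, EB) 𝓘(ℝ, F →L[ℝ] EB) ∞ (A.anchorCoord x₀) x₀ := by
  refine contMDiffAt_clm_of_apply fun w => ?_
  have h := (contMDiffAt_totalSpace.1
    ((A.contMDiff_anchor.comp (frameSection EB F E x₀ w).contMDiff) x₀)).2
  refine h.congr_of_eventuallyEq ?_
  filter_upwards [(trivializationAt EB (TangentSpace 𝓘(ℝ, EB) : M → Type _)
    x₀).open_baseSet.eventually_mem (FiberBundle.mem_baseSet_trivializationAt' x₀)] with x hx
  change (trivializationAt EB (TangentSpace 𝓘(ℝ, EB) : M → Type _)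
    x₀).continuousLinearMapAt ℝ x _ = _
  rw [Trivialization.continuousLinearMapAt_apply, Trivialization.coe_linearMapAt_of_mem _ hx]
  rfl

/-- The values of `θ_L` on the sections which project to a bracket of frame sections. -/
def bracketPairing [FiniteDimensional ℝ F] (x₀ : M) (a : TotalSpace F E) : F →L[ℝ] F →L[ℝ] ℝ :=
  LinearMap.toContinuousLinearMap (LinearMap.toContinuousLinearMap.toLinearMap ∘ₗ
    LinearMap.mk₂ ℝ (fun w w' : F => A.pairing L
      (A.bracket (frameSection EB F E x₀ w) (frameSection EB F E x₀ w')) a)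
      (fun w₁ w₂ w' => by rw [map_add, map_add, LinearMap.add_apply, pairing_add, Pi.add_apply])
      (fun r w w' => by rw [map_smul, map_smul, LinearMap.smul_apply, pairing_smul]; rfl)
      (fun w w₁ w₂ => by rw [map_add, map_add, pairing_add, Pi.add_apply])
      (fun r w w' => by rw [map_smul, map_smul, pairing_smul]; rfl))

theorem contMDiff_bracketPairing [FiniteDimensional ℝ F] (x₀ : M) :
    ContMDiff (𝓘(ℝ, EB).prod 𝓘(ℝ, F)) 𝓘(ℝ, F →L[ℝ] F →L[ℝ] ℝ) ∞ (A.bracketPairing L x₀) := fun _ =>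
  contMDiffAt_clm_of_apply fun _ => contMDiffAt_clm_of_apply fun _ =>
    A.contMDiff_pairing L.contMDiff _ _

end LieAlgebroid

/-! ### The constraint submanifold in coordinates. -/

namespace ConstraintSubmanifold
variable {EP : Type*} [NormedAddCommGroup EP] [NormedSpace ℝ EP]
  {P : Type*} [TopologicalSpace P] [ChartedSpace EP P] [IsManifold 𝓘(ℝ, EP) ∞ P]
  (N : ConstraintSubmanifold EB F E EP P)
  (A : LieAlgebroid EB F E) (L : C^∞⟮𝓘(ℝ, EB).prod 𝓘(ℝ, F), TotalSpace F E; ℝ⟯)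

theorem contMDiff_pr : ContMDiff 𝓘(ℝ, EP) 𝓘(ℝ, EB) ∞ N.pr :=
  (Bundle.contMDiff_proj E (n := ∞) (F := F) (IB := 𝓘(ℝ, EB))).comp N.contMDiff_incl

/-- The fibre coordinates of the inclusion `P → E`, in the trivialization at `x₀`. -/
def fibreCoord (x₀ : M) (p : P) : F := (trivializationAt F E x₀ (N.incl p)).2

/-- The projection `P → M` in the chart at `x₀`. -/
def prCoord (x₀ : M) (p : P) : EB := extChartAt 𝓘(ℝ, EB) x₀ (N.pr p)

theorem contMDiffAt_fibreCoord {x₀ : M} {p : P}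
    (hp : N.pr p ∈ (trivializationAt F E x₀).baseSet) :
    ContMDiffAt 𝓘(ℝ, EP) 𝓘(ℝ, F) ∞ (N.fibreCoord x₀) p :=
  (contMDiffAt_trivialization_snd x₀ hp).comp p (N.contMDiff_incl p)

theorem contMDiffAt_prCoord {x₀ : M} {p : P} (hp : N.pr p ∈ (chartAt EB x₀).source) :
    ContMDiffAt 𝓘(ℝ, EP) 𝓘(ℝ, EB) ∞ (N.prCoord x₀) p :=
  (contMDiffAt_extChartAt' hp).comp p (N.contMDiff_pr p)

theorem mfderiv_prCoord {x₀ : M} {p : P} (hp : N.pr p ∈ (chartAt EB x₀).source)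
    (v : TangentSpace 𝓘(ℝ, EP) p) :
    (mfderiv 𝓘(ℝ, EP) 𝓘(ℝ, EB) (N.prCoord x₀) p : EP →L[ℝ] EB) v =
      (trivializationAt EB (TangentSpace 𝓘(ℝ, EB) : M → Type _) x₀).continuousLinearMapAt ℝ (N.pr p)
        (mfderiv 𝓘(ℝ, EP) 𝓘(ℝ, EB) N.pr p v) := by
  have hn : (∞ : WithTop ℕ∞) ≠ 0 := by simp
  rw [TangentBundle.continuousLinearMapAt_trivializationAt hp]
  have h1 := (((contMDiffAt_extChartAt' hp : ContMDiffAt 𝓘(ℝ, EB) 𝓘(ℝ, EB) ∞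
    (extChartAt 𝓘(ℝ, EB) x₀) (N.pr p))).mdifferentiableAt hn).hasMFDerivAt
  have h2 := (N.contMDiff_pr.mdifferentiable hn p).hasMFDerivAt
  exact congrArg (fun T : EP →L[ℝ] EB => T v) (HasMFDerivAt.comp p h1 h2).mfderiv

theorem mfderiv_pr_eq_of_prCoord {x₀ : M} {p : P} (hp : N.pr p ∈ (chartAt EB x₀).source)
    {v : TangentSpace 𝓘(ℝ, EP) p} {u : TangentSpace 𝓘(ℝ, EB) (N.pr p)}
    (h : (mfderiv 𝓘(ℝ, EP) 𝓘(ℝ, EB) (N.prCoord x₀) p : EP →L[ℝ] EB) v =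
      (trivializationAt EB (TangentSpace 𝓘(ℝ, EB) : M → Type _) x₀).continuousLinearMapAt ℝ (N.pr p)
        u) : mfderiv 𝓘(ℝ, EP) 𝓘(ℝ, EB) N.pr p v = u := by
  have hb : N.pr p ∈ (trivializationAt EB (TangentSpace 𝓘(ℝ, EB) : M → Type _) x₀).baseSet := by
    simpa using hp
  rw [mfderiv_prCoord N hp] at h
  have h1 := congrArg ((trivializationAt EB (TangentSpace 𝓘(ℝ, EB) : M → Type _) x₀).symmL ℝ
    (N.pr p)) h
  rwa [Trivialization.symmL_continuousLinearMapAt _ hb,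
    Trivialization.symmL_continuousLinearMapAt _ hb] at h1

theorem mfderiv_fibreCoord {x₀ : M} {p : P} (hp : N.pr p ∈ (trivializationAt F E x₀).baseSet)
    {v : TangentSpace 𝓘(ℝ, EP) p} {c : E (N.incl p).proj}
    (h : mfderiv 𝓘(ℝ, EP) (𝓘(ℝ, EB).prod 𝓘(ℝ, F)) N.incl p v = verticalVector EB (N.incl p) c) :
    (mfderiv 𝓘(ℝ, EP) 𝓘(ℝ, F) (N.fibreCoord x₀) p : EP →L[ℝ] F) v =
      (trivializationAt F E x₀).continuousLinearMapAt ℝ (N.pr p) c := by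
  have hn : (∞ : WithTop ℕ∞) ≠ 0 := by simp
  refine Eq.trans ?_ (mfderiv_trivialization_verticalVector (EB := EB) x₀ hp c)
  rw [← h]
  have h1 := ((contMDiffAt_trivialization_snd (EB := EB) x₀ hp).mdifferentiableAt hn).hasMFDerivAt
  have h2 := (N.contMDiff_incl.mdifferentiable hn p).hasMFDerivAt
  exact congrArg (fun T : EP →L[ℝ] F => T v) (HasMFDerivAt.comp p h1 h2).mfderiv

theorem exists_mem_V_of_mfderiv_pr_eq_zero [FiniteDimensional ℝ F] {p : P}
    {v : TangentSpace 𝓘(ℝ, EP) p} (h : mfderiv 𝓘(ℝ, EP) 𝓘(ℝ, EB) N.pr p v = 0) :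
    ∃ c ∈ N.V p, mfderiv 𝓘(ℝ, EP) (𝓘(ℝ, EB).prod 𝓘(ℝ, F)) N.incl p v =
      verticalVector EB (N.incl p) c := by
  rw [mfderiv_pr] at h
  obtain ⟨c, hc⟩ := exists_verticalVector_eq _ h
  exact ⟨c, ⟨v, hc.symm⟩, hc.symm⟩

theorem mfderiv_pr_eq_zero {p : P} {v : TangentSpace 𝓘(ℝ, EP) p} {c : E (N.incl p).proj}
    (h : mfderiv 𝓘(ℝ, EP) (𝓘(ℝ, EB).prod 𝓘(ℝ, F)) N.incl p v = verticalVector EB (N.incl p) c) :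
    mfderiv 𝓘(ℝ, EP) 𝓘(ℝ, EB) N.pr p v = 0 := by
  rw [mfderiv_pr, h]
  exact mfderiv_proj_verticalVector _ _

/-- Evaluation at the fixed vector `w` is linear and commutes with the derivative. -/
theorem coordDeriv_framePairing_apply [FiniteDimensional ℝ F] (x₀ : M) (p₀ p : P) (v : EP) (w : F) :
    coordDeriv (EP := EP) p₀ (fun p => A.framePairing L x₀ (N.incl p)) p v w =
    differential 𝓘(ℝ, EP) (fun p => A.pairing L (frameSection EB F E x₀ w) (N.incl p)) p
      ((trivializationAt EP (TangentSpace 𝓘(ℝ, EP) : P → Type _) p₀).symmL ℝ p v) := by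
  have hn : (∞ : WithTop ℕ∞) ≠ 0 := by simp
  have h1 := ((((A.contMDiff_framePairing L x₀).comp N.contMDiff_incl).mdifferentiable hn)
    p).hasMFDerivAt
  have h2 := (ContinuousLinearMap.apply ℝ ℝ w : (F →L[ℝ] ℝ) →L[ℝ] ℝ).hasMFDerivAt
    (x := A.framePairing L x₀ (N.incl p))
  exact (congrArg (fun T : EP →L[ℝ] ℝ =>
    T ((trivializationAt EP (TangentSpace 𝓘(ℝ, EP) : P → Type _) p₀).symmL ℝ p v))
    (HasMFDerivAt.comp p h2 h1).mfderiv).symm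

end ConstraintSubmanifold

/-! ### The linear system for the velocity, and smoothness of the solution. -/

namespace ConstraintSubmanifold
variable {EP : Type*} [NormedAddCommGroup EP] [NormedSpace ℝ EP]
  {P : Type*} [TopologicalSpace P] [ChartedSpace EP P] [IsManifold 𝓘(ℝ, EP) ∞ P]
  (N : ConstraintSubmanifold EB F E EP P)
  (A : LieAlgebroid EB F E) (L : C^∞⟮𝓘(ℝ, EB).prod 𝓘(ℝ, F), TotalSpace F E; ℝ⟯)

/-- The coordinates of the fibre component of the vertical part of a tangent vector of `P`, where
`J` is a right inverse of the derivative of the projection `P → M`. -/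
def verticalCoord (p₀ : P) (J : P → EB →L[ℝ] EP) (p : P) : EP →L[ℝ] F :=
  coordDeriv (EP := EP) p₀ (N.fibreCoord (N.pr p₀)) p ∘L
    (ContinuousLinearMap.id ℝ EP - J p ∘L coordDeriv (EP := EP) p₀ (N.prCoord (N.pr p₀)) p)

/-- Coordinates of tangent vectors of `P` which form elements of `T^V P` with the fibre components
given by `verticalCoord`. -/
def horizontalCoord [FiniteDimensional ℝ F] (p₀ : P) (J : P → EB →L[ℝ] EP) (p : P) : EP →L[ℝ] EP :=
  J p ∘L A.anchorCoord (N.pr p₀) (N.pr p) ∘L N.verticalCoord p₀ J p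

/-- The linear part of the Lagrange-d'Alembert equations for the velocity. -/
def equationMap [FiniteDimensional ℝ F] (p₀ : P) (J : P → EB →L[ℝ] EP) (p : P) :
    EP →L[ℝ] EB × (EP →L[ℝ] ℝ) :=
  (coordDeriv (EP := EP) p₀ (N.prCoord (N.pr p₀)) p).prod
    ((ContinuousLinearMap.compL ℝ EP F ℝ).flip (N.verticalCoord p₀ J p) ∘L
      coordDeriv (EP := EP) p₀ (fun p => A.framePairing L (N.pr p₀) (N.incl p)) p)

/-- The right-hand side of the Lagrange-d'Alembert equations for the velocity. -/
def equationRhs [FiniteDimensional ℝ F] (p₀ : P) (J : P → EB →L[ℝ] EP) (p : P) :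
    EB × (EP →L[ℝ] ℝ) :=
  (A.anchorCoord (N.pr p₀) (N.pr p) (N.fibreCoord (N.pr p₀) p),
    (coordDeriv (EP := EP) p₀ (fun p => A.framePairing L (N.pr p₀) (N.incl p)) p).flip
        (N.fibreCoord (N.pr p₀) p) ∘L N.horizontalCoord A p₀ J p
      + A.bracketPairing L (N.pr p₀) (N.incl p) (N.fibreCoord (N.pr p₀) p) ∘L N.verticalCoord p₀ J p
      - coordDeriv (EP := EP) p₀ (fun p => A.energy L (N.incl p)) p ∘L N.horizontalCoord A p₀ J p)

variable {p₀ : P} {J : P → EB →L[ℝ] EP}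

theorem contMDiffAt_fibreCoord_self : ContMDiffAt 𝓘(ℝ, EP) 𝓘(ℝ, F) ∞ (N.fibreCoord (N.pr p₀)) p₀ :=
  N.contMDiffAt_fibreCoord (FiberBundle.mem_baseSet_trivializationAt' _)

theorem contMDiffAt_prCoord_self : ContMDiffAt 𝓘(ℝ, EP) 𝓘(ℝ, EB) ∞ (N.prCoord (N.pr p₀)) p₀ :=
  N.contMDiffAt_prCoord (mem_chart_source EB _)

theorem contMDiffAt_verticalCoord (hJ : ContMDiffAt 𝓘(ℝ, EP) 𝓘(ℝ, EB →L[ℝ] EP) ∞ J p₀) :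
    ContMDiffAt 𝓘(ℝ, EP) 𝓘(ℝ, EP →L[ℝ] F) ∞ (N.verticalCoord p₀ J) p₀ :=
  (contMDiffAt_coordDeriv N.contMDiffAt_fibreCoord_self).clm_comp
    (contMDiffAt_const.sub (hJ.clm_comp (contMDiffAt_coordDeriv N.contMDiffAt_prCoord_self)))

theorem contMDiffAt_anchorCoord_pr [FiniteDimensional ℝ F] :
    ContMDiffAt 𝓘(ℝ, EP) 𝓘(ℝ, F →L[ℝ] EB) ∞ (fun p => A.anchorCoord (N.pr p₀) (N.pr p)) p₀ :=
  (A.contMDiffAt_anchorCoord (N.pr p₀)).comp p₀ (N.contMDiff_pr p₀)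

theorem contMDiffAt_horizontalCoord [FiniteDimensional ℝ F]
    (hJ : ContMDiffAt 𝓘(ℝ, EP) 𝓘(ℝ, EB →L[ℝ] EP) ∞ J p₀) :
    ContMDiffAt 𝓘(ℝ, EP) 𝓘(ℝ, EP →L[ℝ] EP) ∞ (N.horizontalCoord A p₀ J) p₀ :=
  hJ.clm_comp ((N.contMDiffAt_anchorCoord_pr A).clm_comp (N.contMDiffAt_verticalCoord hJ))

theorem contMDiffAt_coordDeriv_framePairing [FiniteDimensional ℝ F] :
    ContMDiffAt 𝓘(ℝ, EP) 𝓘(ℝ, EP →L[ℝ] F →L[ℝ] ℝ) ∞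
      (coordDeriv (EP := EP) p₀ (fun p => A.framePairing L (N.pr p₀) (N.incl p))) p₀ :=
  contMDiffAt_coordDeriv (((A.contMDiff_framePairing L _).comp N.contMDiff_incl) p₀)

theorem contMDiffAt_equationMap [FiniteDimensional ℝ F] [FiniteDimensional ℝ EP]
    (hJ : ContMDiffAt 𝓘(ℝ, EP) 𝓘(ℝ, EB →L[ℝ] EP) ∞ J p₀) :
    ContMDiffAt 𝓘(ℝ, EP) 𝓘(ℝ, EP →L[ℝ] EB × (EP →L[ℝ] ℝ)) ∞ (N.equationMap A L p₀ J) p₀ := by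
  refine contMDiffAt_clm_of_apply fun v => ?_
  refine ContMDiffAt.prodMk_space
    ((contMDiffAt_coordDeriv N.contMDiffAt_prCoord_self).clm_apply contMDiffAt_const) ?_
  exact ((N.contMDiffAt_coordDeriv_framePairing A L).clm_apply contMDiffAt_const).clm_comp
    (N.contMDiffAt_verticalCoord hJ)

theorem contMDiffAt_equationRhs [FiniteDimensional ℝ F] [FiniteDimensional ℝ EP]
    (hJ : ContMDiffAt 𝓘(ℝ, EP) 𝓘(ℝ, EB →L[ℝ] EP) ∞ J p₀) :
    ContMDiffAt 𝓘(ℝ, EP) 𝓘(ℝ, EB × (EP →L[ℝ] ℝ)) ∞ (N.equationRhs A L p₀ J) p₀ := by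
  have hh := N.contMDiffAt_fibreCoord_self (p₀ := p₀)
  refine ContMDiffAt.prodMk_space ((N.contMDiffAt_anchorCoord_pr A).clm_apply hh) ?_
  have h1 := N.contMDiffAt_horizontalCoord A hJ
  have h2 := ((A.contMDiff_bracketPairing L (N.pr p₀)).comp N.contMDiff_incl) p₀
  have h3 : ContMDiffAt 𝓘(ℝ, EP) 𝓘(ℝ, EP →L[ℝ] ℝ) ∞
      (coordDeriv (EP := EP) p₀ (fun p => A.energy L (N.incl p))) p₀ :=
    contMDiffAt_coordDeriv (((A.contMDiff_energy L).comp N.contMDiff_incl) p₀)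
  refine ContMDiffAt.sub (ContMDiffAt.add ?_ ((h2.clm_apply hh).clm_comp
    (N.contMDiffAt_verticalCoord hJ))) (h3.clm_comp h1)
  exact contMDiffAt_clm_of_apply fun u => ((N.contMDiffAt_coordDeriv_framePairing A L).clm_apply
    (h1.clm_apply contMDiffAt_const)).clm_apply hh

/-- The vectors in the kernel of the projection `P → M` are the elements of `V`. -/
theorem exists_mem_V_of_coordDeriv_prCoord_eq_zero [FiniteDimensional ℝ F] {p : P}
    (hb : N.pr p ∈ (trivializationAt F E (N.pr p₀)).baseSet)
    (hc : N.pr p ∈ (chartAt EB (N.pr p₀)).source) {v : EP}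
    (hv : coordDeriv (EP := EP) p₀ (N.prCoord (N.pr p₀)) p v = 0) :
    ∃ c ∈ N.V p, mfderiv 𝓘(ℝ, EP) (𝓘(ℝ, EB).prod 𝓘(ℝ, F)) N.incl p
        ((trivializationAt EP (TangentSpace 𝓘(ℝ, EP) : P → Type _) p₀).symmL ℝ p v) =
        verticalVector EB (N.incl p) c ∧
      coordDeriv (EP := EP) p₀ (N.fibreCoord (N.pr p₀)) p v =
        (trivializationAt F E (N.pr p₀)).continuousLinearMapAt ℝ (N.pr p) c := by
  have h := N.mfderiv_pr_eq_of_prCoord hc (u := 0)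
    (v := (trivializationAt EP (TangentSpace 𝓘(ℝ, EP) : P → Type _) p₀).symmL ℝ p v)
    (by rw [map_zero]; exact hv)
  obtain ⟨c, hcV, h1⟩ := N.exists_mem_V_of_mfderiv_pr_eq_zero h
  exact ⟨c, hcV, h1, N.mfderiv_fibreCoord hb h1⟩

theorem coordDeriv_prCoord_surjective (p₀ : P) :
    Function.Surjective (coordDeriv (EP := EP) p₀ (N.prCoord (N.pr p₀)) p₀) := by
  intro u
  have hc := mem_chart_source EB (N.pr p₀)
  have hb : N.pr p₀ ∈ (trivializationAt EB (TangentSpace 𝓘(ℝ, EB) : M → Type _)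
    (N.pr p₀)).baseSet := FiberBundle.mem_baseSet_trivializationAt' _
  obtain ⟨v, hv⟩ := N.surjective_mfderiv_proj p₀ ((trivializationAt EB
    (TangentSpace 𝓘(ℝ, EB) : M → Type _) (N.pr p₀)).symmL ℝ (N.pr p₀) u)
  refine ⟨(trivializationAt EP (TangentSpace 𝓘(ℝ, EP) : P → Type _) p₀).continuousLinearMapAt
    ℝ p₀ v, ?_⟩
  rw [coordDeriv_continuousLinearMapAt (mem_chart_source EP p₀)]
  refine (N.mfderiv_prCoord hc v).trans ?_
  have h1 : mfderiv 𝓘(ℝ, EP) 𝓘(ℝ, EB) N.pr p₀ v = _ := hv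
  rw [h1]
  exact Trivialization.continuousLinearMapAt_symmL _ hb u

/-- The first component makes a kernel vector vertical, $c^V$ with $c\in\mathcal V$. The second is
tested on all of `EP`; `verticalCoord` reaches the coordinates of every $b\in\mathcal V$, so no
frame of $\mathcal V$ is needed, and $c$ is in the right kernel of $G^{L,\mathcal V}$. -/
theorem equationMap_injective [FiniteDimensional ℝ F] (hG : LinearMap.ker (N.GLV A L p₀) = ⊥) :
    Function.Injective (N.equationMap A L p₀ J p₀) := by
  refine (injective_iff_map_eq_zero _).2 fun v hv => ?_
  have hb : N.pr p₀ ∈ (trivializationAt F E (N.pr p₀)).baseSet :=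
    FiberBundle.mem_baseSet_trivializationAt' _
  have hc := mem_chart_source EB (N.pr p₀)
  have hv₁ : coordDeriv (EP := EP) p₀ (N.prCoord (N.pr p₀)) p₀ v = 0 := congrArg Prod.fst hv
  have hv₂ : ∀ u, coordDeriv (EP := EP) p₀ (fun p => A.framePairing L (N.pr p₀) (N.incl p)) p₀ v
      (N.verticalCoord p₀ J p₀ u) = 0 := fun u => DFunLike.congr_fun (congrArg Prod.snd hv) u
  obtain ⟨c, hcV, h1, -⟩ := N.exists_mem_V_of_coordDeriv_prCoord_eq_zero hb hc hv₁
  have h2 : c = 0 := by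
    refine (N.ker_GLV_iff_flip A L p₀).1 hG c hcV ?_
    rintro b ⟨vb, hvb⟩
    obtain ⟨z, rfl⟩ := A.proj₂_surjective (N.incl p₀) b
    have h3 := hv₂ ((trivializationAt EP (TangentSpace 𝓘(ℝ, EP) : P → Type _)
      p₀).continuousLinearMapAt ℝ p₀ vb)
    have h4 : N.verticalCoord p₀ J p₀ ((trivializationAt EP (TangentSpace 𝓘(ℝ, EP) : P → Type _)
        p₀).continuousLinearMapAt ℝ p₀ vb) =
        (trivializationAt F E (N.pr p₀)).continuousLinearMapAt ℝ (N.pr p₀)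
          (A.proj₂ (N.incl p₀) z) := by
      -- A vector tangent to the fibre is its own vertical part: the term with `J` drops out.
      have h5 : coordDeriv (EP := EP) p₀ (N.prCoord (N.pr p₀)) p₀
          ((trivializationAt EP (TangentSpace 𝓘(ℝ, EP) : P → Type _)
            p₀).continuousLinearMapAt ℝ p₀ vb) = 0 := by
        rw [coordDeriv_continuousLinearMapAt (mem_chart_source EP p₀)]
        refine (N.mfderiv_prCoord hc vb).trans ?_
        rw [N.mfderiv_pr_eq_zero hvb, map_zero]
      rw [verticalCoord, ContinuousLinearMap.comp_apply, _root_.sub_apply,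
        ContinuousLinearMap.comp_apply, h5, map_zero, sub_zero, ContinuousLinearMap.id_apply,
        coordDeriv_continuousLinearMapAt (mem_chart_source EP p₀)]
      exact N.mfderiv_fibreCoord hb hvb
    rw [h4, coordDeriv_framePairing_apply] at h3
    have h6 := frameSection_continuousLinearMapAt (EB := EB) (F := F) hb
      (SmoothBumpFunction.eq_one _) (A.proj₂ (N.incl p₀) z)
    rw [LieAlgebroid.tensorG_eq, A.cartanTwoForm_verticalLift L (N.incl p₀) z c _ h6, ← h1, ← h3]
    have hn : (∞ : WithTop ℕ∞) ≠ 0 := by simp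
    exact (congrArg (fun T : EP →L[ℝ] ℝ => T ((trivializationAt EP
      (TangentSpace 𝓘(ℝ, EP) : P → Type _) p₀).symmL ℝ p₀ v)) (HasMFDerivAt.comp p₀
        (A.mdifferentiableAt_pairing L _ (N.incl p₀)).hasMFDerivAt
        (N.contMDiff_incl.mdifferentiable hn p₀).hasMFDerivAt).mfderiv).symm
  -- Now the image of the velocity in `T E` is $0^V=0$, and the inclusion is an immersion.
  have h7 := verticalVector_smul EB (N.incl p₀) 0 0
  rw [zero_smul, zero_smul] at h7
  rw [h2, h7] at h1
  have h8 := N.injective_mfderiv_incl p₀ (h1.trans (map_zero _).symm)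
  have h9 := (trivializationAt EP (TangentSpace 𝓘(ℝ, EP) : P → Type _)
    p₀).continuousLinearMapAt_symmL (R := ℝ) (FiberBundle.mem_baseSet_trivializationAt' p₀) v
  rw [h8, map_zero] at h9
  exact h9.symm

/-- Solutions of the Lagrange-d'Alembert equations solve the equations in coordinates. -/
theorem SolvesAt.equationMap_eq [FiniteDimensional ℝ F] (hL : A.IsRegularLagrangian L) {p : P}
    (hp : p ∈ (chartAt EP p₀).source)
    (hb : N.pr p ∈ (trivializationAt F E (N.pr p₀)).baseSet)
    (hbump : bump EB F E (N.pr p₀) (N.pr p) = 1)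
    (hc : N.pr p ∈ (chartAt EB (N.pr p₀)).source)
    (hJ : coordDeriv (EP := EP) p₀ (N.prCoord (N.pr p₀)) p ∘L J p = ContinuousLinearMap.id ℝ EB)
    {z : N.TEP A p} (hz : N.SolvesAt A L p z) :
    N.equationMap A L p₀ J p ((trivializationAt EP (TangentSpace 𝓘(ℝ, EP) : P → Type _)
      p₀).continuousLinearMapAt ℝ p z.1.2) = N.equationRhs A L p₀ J p := by
  have hJ' : ∀ u, coordDeriv (EP := EP) p₀ (N.prCoord (N.pr p₀)) p (J p u) = u :=
    fun u => DFunLike.congr_fun hJ u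
  have hpb : p ∈ (trivializationAt EP (TangentSpace 𝓘(ℝ, EP) : P → Type _) p₀).baseSet := by
    simpa using hp
  have hz₁ := hz.fst_eq hL
  have hfr : ∀ c : E (N.pr p), frameSection EB F E (N.pr p₀)
      ((trivializationAt F E (N.pr p₀)).continuousLinearMapAt ℝ (N.pr p) c) (N.pr p) = c :=
    frameSection_continuousLinearMapAt hb hbump
  have hanc : ∀ c : E (N.pr p), A.anchorCoord (N.pr p₀) (N.pr p)
      ((trivializationAt F E (N.pr p₀)).continuousLinearMapAt ℝ (N.pr p) c) =
      (trivializationAt EB (TangentSpace 𝓘(ℝ, EB) : M → Type _)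
        (N.pr p₀)).continuousLinearMapAt ℝ (N.pr p) (A.anchor (N.pr p) c) := by
    intro c
    conv_rhs => rw [← hfr c]
    rfl
  have hh : N.fibreCoord (N.pr p₀) p =
      (trivializationAt F E (N.pr p₀)).continuousLinearMapAt ℝ (N.pr p) z.1.1 := by
    rw [hz₁, Trivialization.continuousLinearMapAt_apply, Trivialization.coe_linearMapAt_of_mem _ hb]
    rfl
  refine Prod.ext ?_ (ContinuousLinearMap.ext fun u => ?_)
  · change coordDeriv (EP := EP) p₀ (N.prCoord (N.pr p₀)) p _ = A.anchorCoord _ _ _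
    rw [coordDeriv_continuousLinearMapAt hp, hh, hanc,
      show A.anchor (N.pr p) z.1.1 = mfderiv 𝓘(ℝ, EP) 𝓘(ℝ, EB) N.pr p z.1.2 from z.2]
    exact N.mfderiv_prCoord hc z.1.2
  -- `K` is the vertical part of `u` and has a fibre component $c\in\mathcal V$; `w` is a velocity
  -- over $\rho(c)$, so $(c,w)$ is a test element in $\mathcal T^{\mathcal V}\mathcal M$.
  · set K := u - J p (coordDeriv (EP := EP) p₀ (N.prCoord (N.pr p₀)) p u) with hK
    have hK₀ : coordDeriv (EP := EP) p₀ (N.prCoord (N.pr p₀)) p K = 0 := by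
      rw [hK, map_sub, hJ', sub_self]
    obtain ⟨c, hcV, h1⟩ : ∃ c : E (N.pr p), c ∈ N.V p ∧
        coordDeriv (EP := EP) p₀ (N.fibreCoord (N.pr p₀)) p K =
          (trivializationAt F E (N.pr p₀)).continuousLinearMapAt ℝ (N.pr p) c := by
      obtain ⟨c, hcV, -, h1⟩ := N.exists_mem_V_of_coordDeriv_prCoord_eq_zero hb hc hK₀
      exact ⟨c, hcV, h1⟩
    have hvc : N.verticalCoord p₀ J p u =
      (trivializationAt F E (N.pr p₀)).continuousLinearMapAt ℝ (N.pr p) c := h1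
    set w := N.horizontalCoord A p₀ J p u with hw
    have hw' : w = J p (A.anchorCoord (N.pr p₀) (N.pr p)
      ((trivializationAt F E (N.pr p₀)).continuousLinearMapAt ℝ (N.pr p) c)) := by
      rw [← hvc]
      rfl
    have h2 : mfderiv 𝓘(ℝ, EP) 𝓘(ℝ, EB) N.pr p
        ((trivializationAt EP (TangentSpace 𝓘(ℝ, EP) : P → Type _) p₀).symmL ℝ p w) =
        A.anchor (N.pr p) c := by
      refine N.mfderiv_pr_eq_of_prCoord hc ?_
      rw [← hanc]
      refine Eq.trans ?_ (hJ' _)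
      rw [← hw']
      rfl
    -- The extensions are frame sections with the coordinates of the two projections at this `p`.
    -- These constants change with `p`, which is harmless because $\omega_L$ does not depend on the
    -- extensions.
    have h3 := hz.apply_TV N A L ⟨(c, _), h2.symm⟩ hcV _ _ (hfr z.1.1) (hfr c)
    have h4 := (trivializationAt EP (TangentSpace 𝓘(ℝ, EP) : P → Type _)
      p₀).symmL_continuousLinearMapAt (R := ℝ) hpb z.1.2
    have h5 := N.coordDeriv_framePairing_apply A L (N.pr p₀) p₀ p w (N.fibreCoord (N.pr p₀) p)
    have h6 := N.coordDeriv_framePairing_apply A L (N.pr p₀) p₀ p _ (N.verticalCoord p₀ J p u)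
      |>.trans (congrArg _ h4)
    change coordDeriv (EP := EP) p₀ (fun p => A.framePairing L (N.pr p₀) (N.incl p)) p _
        (N.verticalCoord p₀ J p u) =
      coordDeriv (EP := EP) p₀ (fun p => A.framePairing L (N.pr p₀) (N.incl p)) p w
          (N.fibreCoord (N.pr p₀) p)
        + A.bracketPairing L (N.pr p₀) (N.incl p) (N.fibreCoord (N.pr p₀) p)
          (N.verticalCoord p₀ J p u)
        - coordDeriv (EP := EP) p₀ (fun p => A.energy L (N.incl p)) p w
    rw [h5]
    refine h6.trans ?_
    rw [hvc, hh]
    exact h3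

/-- The system holds at all points near `p₀` and is injective at `p₀`, so the velocity is a smooth
left inverse applied to the smooth right-hand side. The auxiliary `J` exists since the projection is
a submersion. -/
theorem contMDiffAt_solution [FiniteDimensional ℝ F] [FiniteDimensional ℝ EP]
    (hL : A.IsRegularLagrangian L) (hG : LinearMap.ker (N.GLV A L p₀) = ⊥)
    {Γ : ∀ p, N.TEP A p} (hΓ : ∀ p, N.SolvesAt A L p (Γ p)) :
    ContMDiffAt 𝓘(ℝ, EP) 𝓘(ℝ, EP) ∞
      (fun p => ((trivializationAt EP (TangentSpace 𝓘(ℝ, EP) : P → Type _)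
        p₀).continuousLinearMapAt ℝ p (Γ p).1.2 : EP)) p₀ := by
  obtain ⟨J, hJ, hJ'⟩ := exists_smooth_rightInverse
    (contMDiffAt_coordDeriv N.contMDiffAt_prCoord_self) (N.coordDeriv_prCoord_surjective p₀)
  obtain ⟨Λ, hΛ, hΛ'⟩ := exists_smooth_leftInverse (N.contMDiffAt_equationMap A L hJ)
    (N.equationMap_injective A L hG)
  refine (hΛ.clm_apply (N.contMDiffAt_equationRhs A L hJ)).congr_of_eventuallyEq ?_
  have hpr := (N.contMDiff_pr p₀).continuousAt
  filter_upwards [hJ', hΛ', chart_source_mem_nhds EP p₀,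
    hpr.eventually (chart_source_mem_nhds EB (N.pr p₀)),
    hpr.eventually (LieAlgebroid.eventually_mem_baseSet_and_bump_eq_one EB F E (N.pr p₀))]
    with p h1 h2 hp hc hb
  rw [← (hΓ p).equationMap_eq N A L hL hp hb.1 hb.2 hc h1]
  exact (DFunLike.congr_fun h2 _).symm

theorem isRegularSystem_of_ker_GLV [FiniteDimensional ℝ F] [FiniteDimensional ℝ EP]
    (hL : A.IsRegularLagrangian L) (hG : ∀ p, LinearMap.ker (N.GLV A L p) = ⊥) :
    N.IsRegularSystem A L := by
  -- An arbitrary pointwise choice suffices: smoothness follows from the equations.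
  choose Γ hΓ using fun p => N.exists_solvesAt A L p (hG p)
  refine ⟨Γ, ⟨?_, fun p₀ => ?_⟩, fun p z => ⟨fun hz => ?_, fun hz => hz ▸ hΓ p⟩⟩
  -- The first component of the solution is the inclusion itself.
  · refine N.contMDiff_incl.congr fun p => ?_
    rw [(hΓ p).fst_eq hL]
    rfl
  · refine contMDiffAt_totalSpace.2 ⟨contMDiffAt_id, ?_⟩
    refine (N.contMDiffAt_solution A L hL (hG p₀) hΓ).congr_of_eventuallyEq ?_
    filter_upwards [(trivializationAt EP (TangentSpace 𝓘(ℝ, EP) : P → Type _)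
      p₀).open_baseSet.eventually_mem (FiberBundle.mem_baseSet_trivializationAt' p₀)] with p hp
    rw [Trivialization.continuousLinearMapAt_apply, Trivialization.coe_linearMapAt_of_mem _ hp]
  · exact hz.unique ((N.ker_GLV_iff_TE_inf_Fspace A L hL p).1 (hG p)) (hΓ p)

end ConstraintSubmanifold

end

theorem mainTheorem11
    {EB : Type*} [NormedAddCommGroup EB] [NormedSpace ℝ EB] [FiniteDimensional ℝ EB]
    {M : Type*} [TopologicalSpace M] [T2Space M] [ChartedSpace EB M] [IsManifold 𝓘(ℝ, EB) ∞ M]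
    {F : Type*} [NormedAddCommGroup F] [NormedSpace ℝ F] [FiniteDimensional ℝ F]
    {E : M → Type*} [∀ x, AddCommGroup (E x)] [∀ x, Module ℝ (E x)]
    [∀ x, TopologicalSpace (E x)] [TopologicalSpace (TotalSpace F E)]
    [FiberBundle F E] [VectorBundle ℝ F E] [ContMDiffVectorBundle ∞ F E 𝓘(ℝ, EB)]
    (A : LieAlgebroid EB F E)
    {EP : Type*} [NormedAddCommGroup EP] [NormedSpace ℝ EP] [FiniteDimensional ℝ EP]
    {P : Type*} [TopologicalSpace P] [ChartedSpace EP P] [IsManifold 𝓘(ℝ, EP) ∞ P]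
    (N : ConstraintSubmanifold EB F E EP P)
    (L : C^∞⟮𝓘(ℝ, EB).prod 𝓘(ℝ, F), TotalSpace F E; ℝ⟯) (hL : A.IsRegularLagrangian L) :
    List.TFAE [
      N.IsRegularSystem A L,
      ∀ p, LinearMap.ker (N.GLV A L p) = ⊥,
      ∀ p, N.TE A p ⊓ N.Fspace A L p = ⊥,
      ∀ p, N.TV A p ⊓ N.TVperp A L p = ⊥] := by
  tfae_have 2 ↔ 3 := forall_congr' fun p => N.ker_GLV_iff_TE_inf_Fspace A L hL p
  tfae_have 2 ↔ 4 := forall_congr' fun p => N.ker_GLV_iff_TV_inf_TVperp A L p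
  tfae_have 1 → 3 := fun h p => h.TE_inf_Fspace N A L p
  tfae_have 2 → 1 := N.isRegularSystem_of_ker_GLV A L hL
  tfae_finish
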